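/- For every $\nu>0$ there are constants $C_\nu,C'_\nu>0$ depending only on $\nu$, and for every $\kappa>0$ a constant $K_{\nu,\kappa}>0$ depending only on $\nu$ and $\kappa$, such that the following holds. Let $n\ge 1$ and let $A=(a_{ij})$ be a random symmetric $n\times n$ matrix whose entries $a_{ij}$, $i\le j$, are independent with $a_{ij}\sim \mathrm{Ber}(p_{ij})$ (zero diagonal entries are the case $p_{ii}=0$), and let $P=(p_{ij})=\mathbb{E}(A)$. Let $\alpha_n>0$, $\bar n_{\min}>0$ and $\bar n_{\max}$ be real numbers such that $p_{ij}\le\alpha_n$ for all $i,j$ and $\alpha_n\bar n_{\min}\le\sum_j p_{ij}\le\alpha_n\bar n_{\max}$ for all $i$, and put $\mu_B=\bar n_{\max}/\bar n_{\min}$. For a matrix $M$ with positive row sums $d_i=\sum_j M_{ij}$, let $L(M)=D^{-1/2}MD^{-1/2}$ with $D=\mathrm{diag}(d_1,\dots,d_n)$, and let $\|\cdot\|$ be the spectral norm. If \[ \alpha_n\ \ge\ C'_\nu\,\mu_B\,\frac{\log n}{\bar n_{\min}}, \] then with probability at least $1-n^{-\nu}$ all row sums of $A$ are positive and \[ \|L(A)-L(P)\|\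 \le\ \frac{C_\nu\,\mu_B\sqrt n}{\bar n_{\min}\sqrt{\alpha_n}} . \] If moreover $\bar n_{\min}\ge\kappa n$ for some $\kappa>0$, then with probability at least $1-n^{-\nu}$ all row sums of $A$ are positive and $\|L(A)-L(P)\|\le K_{\nu,\kappa}/\sqrt{\log n}$. -/

import Mathlib

-- The norm of a matrix is the spectral norm (operator norm for Euclidean norms).
open scoped Matrix.Norms.L2Operator

noncomputable section

/-- The degrees `d_i = ∑ j, M i j` of a (weighted) adjacency matrix. -/
def degree {n : ℕ} (M : Matrix (Fin n) (Fin n) ℝ) (i : Fin n) : ℝ :=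
  ∑ j, M i j

/-- The normalized Laplacian `L(M) = D(M)^{-1/2} M D(M)^{-1/2}` where `D(M)` is the diagonal
matrix of the degrees. It is meaningful when all degrees of `M` are positive. -/
def normalizedLaplacian {n : ℕ} (M : Matrix (Fin n) (Fin n) ℝ) : Matrix (Fin n) (Fin n) ℝ :=
  Matrix.diagonal (fun i => (√(degree M i))⁻¹) * M * Matrix.diagonal (fun i => (√(degree M i))⁻¹)

/-- `A` is a random symmetric matrix whose entry `A i j` has the Bernoulli law on `{0, 1}` with
parameter `p i j`, the entries on and above the diagonal being mutually independent.
A vanishing diagonal is the case `p i i = 0`. -/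
structure IsSymmBernoulliMatrix {Ω : Type*} [MeasurableSpace Ω] (ℙ : MeasureTheory.Measure Ω)
    {n : ℕ} (A : Ω → Matrix (Fin n) (Fin n) ℝ) (p : Matrix (Fin n) (Fin n) unitInterval) :
    Prop where
  symm : ∀ ω, (A ω).IsSymm
  law : ∀ i j, ProbabilityTheory.HasLaw (fun ω => A ω i j)
    (ProbabilityTheory.bernoulliMeasure (1 : ℝ) 0 (p i j)) ℙ
  indep : ProbabilityTheory.iIndepFun
    (fun (e : {e : Fin n × Fin n // e.1 ≤ e.2}) (ω : Ω) => A ω e.1.1 e.1.2) ℙ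

end

/-! Write `D_M` for the diagonal matrix of degrees. The difference `L(A) - L(P)` splits into
`D_A^{-1/2} (A - P) D_A^{-1/2}` and two terms in which `P` is multiplied by `D_A^{-1/2} -
D_P^{-1/2}`. The largeness of `α * nmin` against `log n` keeps all degrees of `A` and `P` above `α *
nmin / 4`, so two estimates remain.

The first is `‖A - P‖ ≲ √(n α)`, by the Kahn–Szemerédi method (`l2_opNorm_sub_le`). The quadratic
form is tested on a grid of integer vectors. Light products `|z i * w j| ≤ 16 √(n α)` are handled by
an exponential moment and a union bound (`HasPoissonTails.light_bound`). Heavy products are summed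
over dyadic levels of `z` and `w`; bounded degrees settle unbalanced levels and a discrepancy
inequality for edge counts between two vertex sets settles the others (`heavy_sum_le`,
`HasPoissonTails.discrepancy_bound`).

The second concerns the terms with `P`, where the Frobenius norm is affordable: since `P i j ≤ α`,
each row has square sum at most `α` times its degree. What is needed is that the squared degree
deviations add up to `O(n * α * nmax)` (`HasPoissonTails.sum_sq_degree_bound`); bounding each
deviation uniformly would lose a logarithm.

All random input comes from one property, `HasPoissonTails`, applied to finite families of
coefficient matrices with thresholds adapted to each member. -/

section

/-! ### Exponential tails of linear statistics of the random matrix. -/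

open MeasureTheory ProbabilityTheory

/-- Exponential tail bounds for all linear statistics of a random symmetric matrix. -/
def HasPoissonTails {Ω : Type*} [MeasurableSpace Ω] (μ : Measure Ω) {n : ℕ}
    (A : Ω → Matrix (Fin n) (Fin n) ℝ) (P : Matrix (Fin n) (Fin n) ℝ) : Prop :=
  ∀ (s : Fin n → Fin n → ℝ) (r : ℝ),
    μ.real {ω | (∑ i, ∑ j, P i j * (Real.exp (2 * s i j) - 1)) / 2 + r
      < ∑ i, ∑ j, s i j * A ω i j} ≤ Real.exp (-r)

lemma sum_sum_eq_sum_upper {n : ℕ} (f : Fin n → Fin n → ℝ) :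
    ∑ i, ∑ j, f i j = ∑ e : {e : Fin n × Fin n // e.1 ≤ e.2},
      (if e.1.1 = e.1.2 then f e.1.1 e.1.2 else f e.1.1 e.1.2 + f e.1.2 e.1.1) := by
  have h1 : ∑ e : {e : Fin n × Fin n // e.1 ≤ e.2},
      (if e.1.1 = e.1.2 then f e.1.1 e.1.2 else f e.1.1 e.1.2 + f e.1.2 e.1.1)
      = ∑ e : Fin n × Fin n, if e.1 ≤ e.2 then
        (if e.1 = e.2 then f e.1 e.2 else f e.1 e.2 + f e.2 e.1) else 0 := by
    rw [← Finset.sum_filter]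
    exact (Finset.sum_subtype (p := fun e : Fin n × Fin n => e.1 ≤ e.2) _ (fun x => by simp)
      (fun e : Fin n × Fin n => if e.1 = e.2 then f e.1 e.2 else f e.1 e.2 + f e.2 e.1)).symm
  have h2 : ∑ e : Fin n × Fin n, (if e.1 ≤ e.2 then
        (if e.1 = e.2 then f e.1 e.2 else f e.1 e.2 + f e.2 e.1) else 0)
      = ∑ i, ∑ j, ((if i ≤ j then f i j else 0) + if i < j then f j i else 0) := by
    rw [Fintype.sum_prod_type]
    refine Finset.sum_congr rfl fun i _ => Finset.sum_congr rfl fun j _ => ?_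
    rcases lt_trichotomy i j with h | h | h
    · simp [h, h.le, h.ne]
    · simp [h]
    · simp [h.not_ge, h.not_gt]
  rw [h1, h2]
  simp_rw [Finset.sum_add_distrib]
  rw [Finset.sum_comm (f := fun i j => if i < j then f j i else 0)]
  simp_rw [← Finset.sum_add_distrib]
  refine Finset.sum_congr rfl fun i _ => Finset.sum_congr rfl fun j _ => ?_
  rcases le_or_gt i j with h | h
  · simp [h, h.not_gt]
  · simp [h, h.not_ge]

lemma integral_bernoulliMeasure_one_zero (p : unitInterval) (f : ℝ → ℝ) :
    ∫ x, f x ∂(bernoulliMeasure (1 : ℝ) 0 p) = p * f 1 + (1 - p) * f 0 := by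
  rw [integral_bernoulliMeasure]
  simp

section

variable {Ω : Type*} [MeasurableSpace Ω] {μ : Measure Ω} {n : ℕ}
  {A : Ω → Matrix (Fin n) (Fin n) ℝ} {p : Matrix (Fin n) (Fin n) unitInterval}

lemma IsSymmBernoulliMatrix.integral_comp (h : IsSymmBernoulliMatrix μ A p) (i j : Fin n)
    {f : ℝ → ℝ} (hf : Measurable f) :
    ∫ ω, f (A ω i j) ∂μ = p i j * f 1 + (1 - p i j) * f 0 := by
  rw [← integral_bernoulliMeasure_one_zero (p i j) f, ← (h.law i j).map_eq,
    integral_map (h.law i j).aemeasurable hf.aestronglyMeasurable]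

lemma IsSymmBernoulliMatrix.param_symm (h : IsSymmBernoulliMatrix μ A p) (i j : Fin n) :
    (p i j : ℝ) = p j i := by
  have h1 := h.integral_comp i j measurable_id
  have h2 := h.integral_comp j i measurable_id
  have h3 : ∀ ω, A ω i j = A ω j i := fun ω => ((h.symm ω).apply i j).symm
  simp only [id, h3] at h1 h2
  linarith

lemma IsSymmBernoulliMatrix.ae_eq_zero_or_one (h : IsSymmBernoulliMatrix μ A p) (i j : Fin n) :
    ∀ᵐ ω ∂μ, A ω i j = 0 ∨ A ω i j = 1 := by
  have hm : MeasurableSet {x : ℝ | x = 0 ∨ x = 1} :=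
    (measurableSet_singleton (0 : ℝ)).union (measurableSet_singleton 1)
  rw [(h.law i j).ae_iff (p := fun x => x = 0 ∨ x = 1) (measurableSet_setOfPred.1 hm)]
  rw [ae_iff, bernoulliMeasure_def]
  simp

lemma IsSymmBernoulliMatrix.ae_nonneg (h : IsSymmBernoulliMatrix μ A p) :
    ∀ᵐ ω ∂μ, ∀ i j, 0 ≤ A ω i j := by
  rw [ae_all_iff]; intro i
  rw [ae_all_iff]; intro j
  filter_upwards [h.ae_eq_zero_or_one i j] with ω hω
  rcases hω with h | h <;> simp [h]

lemma IsSymmBernoulliMatrix.mgf_entry (h : IsSymmBernoulliMatrix μ A p) (i j : Fin n) (c : ℝ) :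
    mgf (fun ω => c * A ω i j) μ 1 = 1 + p i j * (Real.exp c - 1) := by
  have := h.integral_comp i j (f := fun x => Real.exp (1 * (c * x))) (by fun_prop)
  rw [mgf, this]
  simp
  ring

/-- Chernoff's bound at parameter 1. The entries `(i, j)` and `(j, i)` coincide, so an independent
variable carries the coefficient `s i j + s j i`; the factors 2 and 1/2 in the exponent separate the
two coefficients again, and so `s` need not be symmetric. -/
lemma IsSymmBernoulliMatrix.hasPoissonTails [IsProbabilityMeasure μ]
    (h : IsSymmBernoulliMatrix μ A p)
    {P : Matrix (Fin n) (Fin n) ℝ} (hP : ∀ i j, P i j = (p i j : ℝ)) :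
    HasPoissonTails μ A P := by
  intro s r
  set c : {e : Fin n × Fin n // e.1 ≤ e.2} → ℝ := fun e =>
    if e.1.1 = e.1.2 then s e.1.1 e.1.2 else s e.1.1 e.1.2 + s e.1.2 e.1.1 with hc
  set X : {e : Fin n × Fin n // e.1 ≤ e.2} → Ω → ℝ := fun e ω => c e * A ω e.1.1 e.1.2 with hX
  have hsum : ∀ ω, ∑ i, ∑ j, s i j * A ω i j = (∑ e, X e) ω := by
    intro ω
    rw [sum_sum_eq_sum_upper, Finset.sum_apply]
    refine Finset.sum_congr rfl fun e _ => ?_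
    have h3 : A ω e.1.2 e.1.1 = A ω e.1.1 e.1.2 := (h.symm ω).apply _ _
    simp only [hX, hc, h3]
    split_ifs <;> ring
  have hind : iIndepFun X μ :=
    h.indep.comp (fun e x => c e * x) (fun e => by fun_prop)
  have hmeas : ∀ e, AEMeasurable (X e) μ := fun e => (h.law _ _).aemeasurable.const_mul _
  have hmgf : mgf (∑ e, X e) μ 1 ≤
      Real.exp ((∑ i, ∑ j, P i j * (Real.exp (2 * s i j) - 1)) / 2) := by
    rw [hind.mgf_sum₀ hmeas, Finset.sum_div]
    simp_rw [Finset.sum_div]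
    rw [sum_sum_eq_sum_upper, Real.exp_sum]
    refine Finset.prod_le_prod (fun e _ => mgf_nonneg) fun e _ => ?_
    rw [hX, h.mgf_entry]
    refine le_trans (by rw [add_comm]; exact Real.add_one_le_exp _) (Real.exp_le_exp.2 ?_)
    have h0 : (0 : ℝ) ≤ p e.1.1 e.1.2 := (p e.1.1 e.1.2).2.1
    have hexp : ∀ x : ℝ, Real.exp (2 * x) = Real.exp x ^ 2 := fun x => by
      rw [← Real.exp_nat_mul]; norm_num
    simp only [hc, hP, ← h.param_symm e.1.1 e.1.2]
    -- Both cases are `x * y ≤ (x ^ 2 + y ^ 2) / 2` for exponentials: with `y = 1` on the diagonal,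
    -- and with the two mirrored coefficients off it.
    split_ifs with he
    · rw [hexp]
      nlinarith [mul_nonneg h0 (sq_nonneg (Real.exp (s e.1.1 e.1.2) - 1))]
    · rw [hexp, hexp, Real.exp_add]
      nlinarith [mul_nonneg h0 (sq_nonneg (Real.exp (s e.1.1 e.1.2) - Real.exp (s e.1.2 e.1.1)))]
  have hae : ∀ᵐ ω ∂μ, ∀ e : {e : Fin n × Fin n // e.1 ≤ e.2},
      A ω e.1.1 e.1.2 = 0 ∨ A ω e.1.1 e.1.2 = 1 :=
    ae_all_iff.2 fun e => h.ae_eq_zero_or_one _ _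
  have hint : Integrable (fun ω => Real.exp (1 * (∑ e, X e) ω)) μ := by
    refine Integrable.of_bound (C := Real.exp (∑ e, |c e|)) ?_ ?_
    · have : AEMeasurable (∑ e, X e) μ := Finset.aemeasurable_sum _ fun e _ => hmeas e
      exact (Real.measurable_exp.comp_aemeasurable (this.const_mul 1)).aestronglyMeasurable
    · filter_upwards [hae] with ω hω
      rw [Real.norm_eq_abs, Real.abs_exp, one_mul, Finset.sum_apply]
      refine Real.exp_le_exp.2 (Finset.sum_le_sum fun e _ => ?_)
      rcases hω e with h0 | h0
      · simp [hX, h0]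
      · simpa [hX, h0] using le_abs_self _
  have hch := measure_ge_le_exp_mul_mgf (μ := μ) (X := ∑ e, X e) (t := 1)
    ((∑ i, ∑ j, P i j * (Real.exp (2 * s i j) - 1)) / 2 + r) zero_le_one hint
  calc _ ≤ μ.real {ω | (∑ i, ∑ j, P i j * (Real.exp (2 * s i j) - 1)) / 2 + r ≤ (∑ e, X e) ω} := by
        refine measureReal_mono fun ω hω => ?_
        simp only [Set.mem_ofPred_eq] at hω ⊢
        rw [← hsum]; exact hω.le
    _ ≤ _ := hch
    _ ≤ Real.exp (-1 * ((∑ i, ∑ j, P i j * (Real.exp (2 * s i j) - 1)) / 2 + r)) *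
        Real.exp ((∑ i, ∑ j, P i j * (Real.exp (2 * s i j) - 1)) / 2) := by gcongr
    _ = Real.exp (-r) := by rw [← Real.exp_add]; congr 1; ring

lemma HasPoissonTails.union_bound {P : Matrix (Fin n) (Fin n) ℝ} (h : HasPoissonTails μ A P)
    {ι : Type*} (T : Finset ι) (s : ι → Fin n → Fin n → ℝ) (r : ι → ℝ) :
    μ.real {ω | ∃ t ∈ T, (∑ i, ∑ j, P i j * (Real.exp (2 * s t i j) - 1)) / 2 + r t
      < ∑ i, ∑ j, s t i j * A ω i j} ≤ ∑ t ∈ T, Real.exp (-r t) := by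
  have : {ω | ∃ t ∈ T, (∑ i, ∑ j, P i j * (Real.exp (2 * s t i j) - 1)) / 2 + r t
      < ∑ i, ∑ j, s t i j * A ω i j} = ⋃ t ∈ T, {ω |
      (∑ i, ∑ j, P i j * (Real.exp (2 * s t i j) - 1)) / 2 + r t
      < ∑ i, ∑ j, s t i j * A ω i j} := by ext; simp
  rw [this]
  exact (measureReal_biUnion_finset_le _ _).trans (Finset.sum_le_sum fun t _ => h _ _)

end

end

/-! ### Entropy of subsets and sums over dyadic levels. -/

/-- The entropy `m log (e n / m)` of the family of `m`-element subsets of an `n`-element set. -/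
noncomputable def subsetEntropy (n m : ℕ) : ℝ := m * (1 + Real.log (n / m))

lemma subsetEntropy_zero (n : ℕ) : subsetEntropy n 0 = 0 := by simp [subsetEntropy]

lemma subsetEntropy_nonneg {n m : ℕ} (h : m ≤ n) : 0 ≤ subsetEntropy n m := by
  rcases Nat.eq_zero_or_pos m with rfl | hm
  · simp [subsetEntropy]
  · have hm' : (0 : ℝ) < m := by exact_mod_cast hm
    have : 0 ≤ Real.log (n / m) := Real.log_nonneg (by rw [one_le_div hm']; exact_mod_cast h)
    unfold subsetEntropy; positivity

/-- The tangent-line inequality `log x ≤ x - 1` at `x = e^(1 - r) * n / m`. It linearises the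
entropy in `m`, with a free slope `r` to be tuned to the dyadic level. -/
lemma subsetEntropy_le {n : ℕ} (hn : 0 < n) (m : ℕ) (r : ℝ) :
    subsetEntropy n m ≤ m * r + n * Real.exp (1 - r) := by
  rcases Nat.eq_zero_or_pos m with rfl | hm
  · simp [subsetEntropy]; positivity
  have hm' : (0 : ℝ) < m := by exact_mod_cast hm
  have hn' : (0 : ℝ) < n := by exact_mod_cast hn
  have h1 : Real.log (Real.exp (1 - r) * (n / m)) = 1 - r + Real.log (n / m) := by
    rw [Real.log_mul (Real.exp_pos _).ne' (by positivity), Real.log_exp]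
  have h2 := Real.log_le_sub_one_of_pos (x := Real.exp (1 - r) * (n / m)) (by positivity)
  have h3 : 1 + Real.log (n / m) ≤ r + Real.exp (1 - r) * (n / m) := by linarith
  calc subsetEntropy n m ≤ m * (r + Real.exp (1 - r) * (n / m)) := by
        unfold subsetEntropy; gcongr
    _ = _ := by field_simp

lemma sum_two_pow_div_succ_le (m : ℕ) :
    ∑ k ∈ Finset.range (m + 1), (2 : ℝ) ^ k / (k + 1) ≤ 4 * 2 ^ m / (m + 1) := by
  induction m with
  | zero => norm_num
  | succ m ih =>
    rw [Finset.sum_range_succ]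
    rcases Nat.eq_zero_or_pos m with rfl | hm
    · norm_num [Finset.sum_range_succ]
    have hm' : (1 : ℝ) ≤ m := by exact_mod_cast hm
    have : (4 : ℝ) * 2 ^ m / (m + 1) ≤ 3 * 2 ^ (m + 1) / ((m + 1 : ℕ) + 1) := by
      push_cast
      rw [div_le_div_iff₀ (by positivity) (by positivity), pow_succ]
      nlinarith [pow_pos (two_pos : (0 : ℝ) < 2) m]
    calc _ ≤ 3 * 2 ^ (m + 1) / (((m + 1 : ℕ) : ℝ) + 1) + 2 ^ (m + 1) / (((m + 1 : ℕ) : ℝ) + 1) := by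
          linarith
      _ = _ := by ring

section

variable {n : ℕ}

/-- The indices `i` with `2 ^ a ≤ z i < 2 ^ (a + 1)`. -/
def dyadicLevel (z : Fin n → ℕ) (a : ℕ) : Finset (Fin n) :=
  Finset.univ.filter fun i => z i ≠ 0 ∧ Nat.log 2 (z i) = a

lemma sum_four_pow_mul_card_dyadicLevel_le (z : Fin n → ℕ) (L : ℕ) :
    ∑ a ∈ Finset.range L, (4 : ℝ) ^ a * (dyadicLevel z a).card ≤ ∑ i, (z i : ℝ) ^ 2 := by
  have h : ∀ a, (4 : ℝ) ^ a * (dyadicLevel z a).card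
      = ∑ i, if z i ≠ 0 ∧ Nat.log 2 (z i) = a then (4 : ℝ) ^ a else 0 := by
    intro a
    rw [← Finset.sum_filter, Finset.sum_const, nsmul_eq_mul, mul_comm]; rfl
  simp_rw [h]
  rw [Finset.sum_comm]
  refine Finset.sum_le_sum fun i _ => ?_
  by_cases hz : z i = 0
  · simp [hz]
  simp only [ne_eq, hz, not_false_eq_true, true_and]
  rw [Finset.sum_ite_eq]
  split_ifs
  · have : (2 : ℝ) ^ Nat.log 2 (z i) ≤ z i := by exact_mod_cast Nat.pow_log_le_self 2 hz
    calc (4 : ℝ) ^ Nat.log 2 (z i) = ((2 : ℝ) ^ Nat.log 2 (z i)) ^ 2 := by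
          rw [← pow_mul, mul_comm, pow_mul]; norm_num
      _ ≤ _ := by gcongr
  · positivity

lemma card_dyadicLevel_le (z : Fin n → ℕ) (a : ℕ) : (dyadicLevel z a).card ≤ n := by
  simpa using Finset.card_le_univ (dyadicLevel z a)

/-- The divisor `2 * b + 1` pays for the logarithm in the entropy. With slope `2 * (2 * b + 1)` the
linear part becomes twice `4 ^ b` times the level size, which sums to at most `∑ z i ^ 2`, and the
exponential remainder beats `4 ^ b` and leaves a geometric series. -/
lemma sum_entropy_dyadicLevel_le (hn : 0 < n) (z : Fin n → ℕ) (hz : ∑ i, (z i : ℝ) ^ 2 ≤ 16 * n)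
    (L : ℕ) :
    ∑ b ∈ Finset.range L, (4 : ℝ) ^ b * subsetEntropy n (dyadicLevel z b).card / (2 * b + 1)
      ≤ 34 * n := by
  have hexp : ∀ b : ℕ, (4 : ℝ) ^ b * Real.exp (1 - 2 * (2 * b + 1)) ≤ (1 / 2) ^ b := by
    intro b
    have h1 : Real.exp (1 - 2 * (2 * b + 1)) ≤ (1 / 8) ^ b := by
      have : Real.exp (-1) ≤ 1 / 2 := by
        rw [Real.exp_neg, one_div]
        exact inv_anti₀ two_pos (by linarith [Real.add_one_le_exp (1 : ℝ)])
      calc Real.exp (1 - 2 * (2 * b + 1)) ≤ Real.exp ((3 * b : ℕ) * (-1 : ℝ)) := by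
            refine Real.exp_le_exp.2 ?_
            push_cast
            nlinarith [(Nat.cast_nonneg b : (0 : ℝ) ≤ b)]
        _ = Real.exp (-1) ^ (3 * b) := by rw [Real.exp_nat_mul]
        _ ≤ (1 / 2) ^ (3 * b) := by gcongr
        _ = (1 / 8) ^ b := by rw [pow_mul]; norm_num
    calc (4 : ℝ) ^ b * Real.exp (1 - 2 * (2 * b + 1)) ≤ 4 ^ b * (1 / 8) ^ b := by gcongr
      _ = (1 / 2) ^ b := by rw [← mul_pow]; norm_num
  have hterm : ∀ b : ℕ, (4 : ℝ) ^ b * subsetEntropy n (dyadicLevel z b).card / (2 * b + 1)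
      ≤ 2 * (4 ^ b * (dyadicLevel z b).card) + n * (1 / 2) ^ b := by
    intro b
    rw [div_le_iff₀ (by positivity)]
    have h := subsetEntropy_le hn (dyadicLevel z b).card (2 * (2 * b + 1))
    calc (4 : ℝ) ^ b * subsetEntropy n (dyadicLevel z b).card
        ≤ 4 ^ b * ((dyadicLevel z b).card * (2 * (2 * b + 1))
          + n * Real.exp (1 - 2 * (2 * b + 1))) := by gcongr
      _ = 2 * (4 ^ b * (dyadicLevel z b).card) * (2 * b + 1)
          + n * (4 ^ b * Real.exp (1 - 2 * (2 * b + 1))) := by ring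
      _ ≤ 2 * (4 ^ b * (dyadicLevel z b).card) * (2 * b + 1)
          + n * (1 / 2) ^ b := by gcongr; exact hexp b
      _ ≤ _ := by
          rw [add_mul]
          have h1 : (1 : ℝ) ≤ 2 * b + 1 := by nlinarith [(Nat.cast_nonneg b : (0 : ℝ) ≤ b)]
          have h2 : (0 : ℝ) ≤ n * (1 / 2) ^ b := by positivity
          nlinarith
  have hgeom : ∑ b ∈ Finset.range L, (1 / 2 : ℝ) ^ b ≤ 2 := by
    have := Summable.sum_le_tsum (Finset.range L) (fun b _ => by positivity)
      summable_geometric_two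
    rwa [tsum_geometric_two] at this
  calc _ ≤ ∑ b ∈ Finset.range L, (2 * ((4 : ℝ) ^ b * (dyadicLevel z b).card) + n * (1 / 2) ^ b) :=
        Finset.sum_le_sum fun b _ => hterm b
    _ = 2 * ∑ b ∈ Finset.range L, (4 : ℝ) ^ b * (dyadicLevel z b).card
        + n * ∑ b ∈ Finset.range L, (1 / 2 : ℝ) ^ b := by
        rw [Finset.sum_add_distrib, Finset.mul_sum, Finset.mul_sum]
    _ ≤ 2 * (16 * n) + n * 2 := by
        gcongr
        exact (sum_four_pow_mul_card_dyadicLevel_le z L).trans hz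
    _ = _ := by ring

/-- For fixed `b` the exponents `a + b - δ` are distinct and at most `2 * b`, so the sum is
comparable to its top term. This produces the divisor `2 * b + 1`. -/
lemma sum_level_weights_le (δ b : ℕ) (S : Finset ℕ)
    (hS : ∀ a ∈ S, δ ≤ a + b ∧ a < b + δ) :
    ∑ a ∈ S, (2 : ℝ) ^ (a + b) / ((a + b - δ : ℕ) + 1) ≤ 4 * 2 ^ δ * 4 ^ b / (2 * b + 1) := by
  have h1 : ∀ a ∈ S, (2 : ℝ) ^ (a + b) / ((a + b - δ : ℕ) + 1)
      = 2 ^ δ * (2 ^ (a + b - δ) / ((a + b - δ : ℕ) + 1)) := by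
    intro a ha
    rw [← mul_div_assoc, ← pow_add]
    congr 2
    have := (hS a ha).1
    omega
  have hinj : Set.InjOn (fun a => a + b - δ) (S : Set ℕ) := by
    intro a ha a' ha' h
    have := (hS a ha).1
    have := (hS a' ha').1
    simp only at h
    omega
  rw [Finset.sum_congr rfl h1, ← Finset.mul_sum,
    ← Finset.sum_image (g := fun a => a + b - δ) (f := fun k : ℕ => (2 : ℝ) ^ k / (k + 1)) hinj]
  have hsub : S.image (fun a => a + b - δ) ⊆ Finset.range (2 * b + 1) := by
    intro k hk
    obtain ⟨a, ha, rfl⟩ := Finset.mem_image.1 hk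
    have := hS a ha
    simp only [Finset.mem_range]
    omega
  calc _ ≤ 2 ^ δ * ∑ k ∈ Finset.range (2 * b + 1), (2 : ℝ) ^ k / (k + 1) := by
        refine mul_le_mul_of_nonneg_left ?_ (by positivity)
        exact Finset.sum_le_sum_of_subset_of_nonneg hsub fun _ _ _ => by positivity
    _ ≤ 2 ^ δ * (4 * 2 ^ (2 * b) / ((2 * b : ℕ) + 1)) := by
        gcongr; exact sum_two_pow_div_succ_le _
    _ = _ := by rw [pow_mul]; push_cast; norm_num; ring

end

/-! ### Heavy products. -/

section

variable {n : ℕ}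

/-- The pairs of dyadic levels `(a, b)` with `2 ^ (a + b) ≥ 2 ^ δ` and a ratio of less than
`2 ^ δ`. -/
def balancedLevels (L δ : ℕ) : Finset (ℕ × ℕ) :=
  (Finset.range L ×ˢ Finset.range L).filter fun q =>
    δ ≤ q.1 + q.2 ∧ q.1 < q.2 + δ ∧ q.2 < q.1 + δ

/-- If the levels of `z` and `w` differ by at least `δ`, the product is dominated by the square of
the larger factor divided by `2 ^ δ`, which a degree bound will control. Otherwise the pair is
charged to its balanced pair of levels. -/
lemma heavy_term_le {z w L δ : ℕ} {d B : ℝ} (hB : 0 ≤ B) (hδ : (2 : ℝ) ^ δ ≤ √d)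
    (hzL : z < L) (hwL : w < L) :
    (if 16 * √d < (z : ℝ) * w then (z : ℝ) * w * B else 0)
      ≤ 2 * (z : ℝ) ^ 2 / 2 ^ δ * B + 2 * (w : ℝ) ^ 2 / 2 ^ δ * B
        + ∑ q ∈ balancedLevels L δ, if (z ≠ 0 ∧ Nat.log 2 z = q.1) ∧ (w ≠ 0 ∧ Nat.log 2 w = q.2)
          then 4 * 2 ^ (q.1 + q.2) * B else 0 := by
  have hS : 0 ≤ ∑ q ∈ balancedLevels L δ,
      if (z ≠ 0 ∧ Nat.log 2 z = q.1) ∧ (w ≠ 0 ∧ Nat.log 2 w = q.2)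
          then 4 * 2 ^ (q.1 + q.2) * B else 0 :=
    Finset.sum_nonneg fun q _ => by split_ifs <;> positivity
  have hz2 : 0 ≤ 2 * (z : ℝ) ^ 2 / 2 ^ δ * B := by positivity
  have hw2 : 0 ≤ 2 * (w : ℝ) ^ 2 / 2 ^ δ * B := by positivity
  split_ifs with h
  swap
  · linarith
  have hz : z ≠ 0 := by
    rintro rfl
    simp at h
    linarith [Real.sqrt_nonneg d]
  have hw : w ≠ 0 := by
    rintro rfl
    simp at h
    linarith [Real.sqrt_nonneg d]
  set a := Nat.log 2 z with ha
  set b := Nat.log 2 w with hb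
  have haz : (2 : ℝ) ^ a ≤ z := by exact_mod_cast Nat.pow_log_le_self 2 hz
  have hbw : (2 : ℝ) ^ b ≤ w := by exact_mod_cast Nat.pow_log_le_self 2 hw
  have hza : (z : ℝ) ≤ 2 * 2 ^ a := by
    have := (Nat.lt_pow_succ_log_self one_lt_two z).le
    rw [pow_succ, mul_comm] at this
    exact_mod_cast this
  have hwb : (w : ℝ) ≤ 2 * 2 ^ b := by
    have := (Nat.lt_pow_succ_log_self one_lt_two w).le
    rw [pow_succ, mul_comm] at this
    exact_mod_cast this
  have key : ∀ {x y : ℝ} {c e : ℕ}, 0 ≤ x → (2 : ℝ) ^ c ≤ x → y ≤ 2 * 2 ^ e → e + δ ≤ c →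
      x * y ≤ 2 * x ^ 2 / 2 ^ δ := by
    intro x y c e hx0 hx hy hce
    rw [le_div_iff₀ (by positivity)]
    have h1 : (2 : ℝ) ^ e * 2 ^ δ ≤ x := by
      rw [← pow_add]
      exact (pow_le_pow_right₀ one_le_two hce).trans hx
    have h2 : y * 2 ^ δ ≤ 2 * x := by
      calc y * 2 ^ δ ≤ 2 * 2 ^ e * 2 ^ δ := by gcongr
        _ ≤ 2 * x := by linarith
    nlinarith
  rcases le_or_gt (b + δ) a with h1 | h1
  · have := mul_le_mul_of_nonneg_right (key (Nat.cast_nonneg z) haz hwb h1) hB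
    linarith
  rcases le_or_gt (a + δ) b with h2 | h2
  · have := mul_le_mul_of_nonneg_right (key (Nat.cast_nonneg w) hbw hza h2) hB
    rw [mul_comm (w : ℝ)] at this
    linarith
  -- A pair with `a + b < δ` has product at most `4 * 2 ^ δ ≤ 4 * √d`, so it is not heavy.
  have h3 : δ ≤ a + b := by
    by_contra hlt
    have h4 : (2 : ℝ) ^ (a + b) ≤ 2 ^ δ := pow_le_pow_right₀ one_le_two (by omega)
    have h5 : (z : ℝ) * w ≤ (2 * 2 ^ a) * (2 * 2 ^ b) := by gcongr
    rw [pow_add] at h4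
    nlinarith [pow_pos (two_pos : (0 : ℝ) < 2) δ]
  have haL : a < L := (Nat.log_le_self 2 z).trans_lt hzL
  have hbL : b < L := (Nat.log_le_self 2 w).trans_lt hwL
  have hmem : (a, b) ∈ balancedLevels L δ := by
    simp [balancedLevels, haL, hbL, h1, h2, h3]
  have hle := Finset.single_le_sum (f := fun q : ℕ × ℕ =>
      if (z ≠ 0 ∧ a = q.1) ∧ (w ≠ 0 ∧ b = q.2)
          then 4 * 2 ^ (q.1 + q.2) * B else 0)
      (fun q _ => by split_ifs <;> positivity) hmem
  simp only [ne_eq, hz, hw, not_false_eq_true, and_self, if_true] at hle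
  have h5 : (z : ℝ) * w * B ≤ 4 * 2 ^ (a + b) * B := by
    have : (z : ℝ) * w ≤ (2 * 2 ^ a) * (2 * 2 ^ b) := by gcongr
    rw [pow_add]
    calc (z : ℝ) * w * B ≤ (2 * 2 ^ a) * (2 * 2 ^ b) * B := by gcongr
      _ = _ := by ring
  simp only [ne_eq, hz, hw, not_false_eq_true, true_and]
  simp only [true_and] at hle
  linarith

lemma sum_balancedLevels_le {L δ : ℕ} (f : ℕ → ℝ) (hf : ∀ b, 0 ≤ f b) :
    ∑ q ∈ balancedLevels L δ, (2 : ℝ) ^ (q.1 + q.2) / ((q.1 + q.2 - δ : ℕ) + 1) * f q.2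
      ≤ 4 * 2 ^ δ * ∑ b ∈ Finset.range L, 4 ^ b * f b / (2 * b + 1) := by
  unfold balancedLevels
  rw [Finset.sum_filter, Finset.sum_product_right, Finset.mul_sum]
  refine Finset.sum_le_sum fun b _ => ?_
  dsimp only
  rw [← Finset.sum_filter, ← Finset.sum_mul]
  have := sum_level_weights_le δ b
    ((Finset.range L).filter fun a => δ ≤ a + b ∧ a < b + δ ∧ b < a + δ) (by
      intro a ha
      have := (Finset.mem_filter.1 ha).2
      exact ⟨this.1, this.2.1⟩)
  calc _ ≤ 4 * 2 ^ δ * 4 ^ b / (2 * b + 1) * f b := mul_le_mul_of_nonneg_right this (hf b)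
    _ = _ := by ring

lemma sum_balancedLevels_le' {L δ : ℕ} (f : ℕ → ℝ) (hf : ∀ b, 0 ≤ f b) :
    ∑ q ∈ balancedLevels L δ, (2 : ℝ) ^ (q.1 + q.2) / ((q.1 + q.2 - δ : ℕ) + 1) * f q.1
      ≤ 4 * 2 ^ δ * ∑ b ∈ Finset.range L, 4 ^ b * f b / (2 * b + 1) := by
  refine le_trans (le_of_eq ?_) (sum_balancedLevels_le (L := L) (δ := δ) f hf)
  refine Finset.sum_nbij' Prod.swap Prod.swap ?_ ?_ ?_ ?_ ?_
  · simp only [balancedLevels, Finset.mem_filter, Finset.mem_product, Finset.mem_range]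
    rintro ⟨a, b⟩ h
    simp only [Prod.swap] at *
    omega
  · simp only [balancedLevels, Finset.mem_filter, Finset.mem_product, Finset.mem_range]
    rintro ⟨a, b⟩ h
    simp only [Prod.swap] at *
    omega
  · simp
  · simp
  · rintro ⟨a, b⟩ _
    simp [add_comm]

lemma lt_of_sum_sq_le {z : Fin n → ℕ} (hz : ∑ i, (z i : ℝ) ^ 2 ≤ 16 * n)
    (i : Fin n) : z i < 16 * n + 1 := by
  have h1 : (z i : ℝ) ^ 2 ≤ ∑ i, (z i : ℝ) ^ 2 :=
    Finset.single_le_sum (f := fun i => (z i : ℝ) ^ 2) (fun _ _ => by positivity)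
      (Finset.mem_univ i)
  have h2 : (z i) ^ 2 ≤ 16 * n := by exact_mod_cast h1.trans hz
  nlinarith [Nat.le_self_pow two_ne_zero (z i)]

/-- The discrepancy inequality is used for each pair of levels with its own parameter `k = a + b -
δ`. Then `2 ^ (a + b) * 2 ^ k = 4 ^ a * 4 ^ b / 2 ^ δ`, so the main term factors into the two square
sums, and division by `k + 1` gives the entropy terms summable weights. -/
lemma balanced_level_sum_le (hn : 0 < n) {B : Fin n → Fin n → ℝ}
    {α C : ℝ} (hα : 0 < α) (hC : 0 ≤ C) {δ : ℕ}
    (hdisc : ∀ (I J : Finset (Fin n)) (k : ℕ), k ≤ 32 * n →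
      (k + 1) * ∑ i ∈ I, ∑ j ∈ J, B i j
        ≤ 4 * α * I.card * J.card * 2 ^ k
          + C * (subsetEntropy n I.card + subsetEntropy n J.card))
    {z w : Fin n → ℕ} (hz : ∑ i, (z i : ℝ) ^ 2 ≤ 16 * n) (hw : ∑ i, (w i : ℝ) ^ 2 ≤ 16 * n) :
    ∑ q ∈ balancedLevels (16 * n + 1) δ, 4 * (2 : ℝ) ^ (q.1 + q.2) *
      ∑ i ∈ dyadicLevel z q.1, ∑ j ∈ dyadicLevel w q.2, B i j
      ≤ 4096 * α * n ^ 2 / 2 ^ δ + 1088 * C * 2 ^ δ * n := by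
  set L := 16 * n + 1 with hL
  have hterm : ∀ q ∈ balancedLevels L δ, 4 * (2 : ℝ) ^ (q.1 + q.2) *
      ∑ i ∈ dyadicLevel z q.1, ∑ j ∈ dyadicLevel w q.2, B i j
      ≤ 16 * α / 2 ^ δ * ((4 ^ q.1 * (dyadicLevel z q.1).card)
          * (4 ^ q.2 * (dyadicLevel w q.2).card))
        + 4 * C * ((2 : ℝ) ^ (q.1 + q.2) / ((q.1 + q.2 - δ : ℕ) + 1)
            * subsetEntropy n (dyadicLevel z q.1).card)
        + 4 * C * ((2 : ℝ) ^ (q.1 + q.2) / ((q.1 + q.2 - δ : ℕ) + 1)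
            * subsetEntropy n (dyadicLevel w q.2).card) := by
    rintro ⟨a, b⟩ hq
    simp only [balancedLevels, Finset.mem_filter, Finset.mem_product, Finset.mem_range] at hq
    dsimp only
    obtain ⟨k, hk⟩ : ∃ k, k = a + b - δ := ⟨_, rfl⟩
    have h := hdisc (dyadicLevel z a) (dyadicLevel w b) k (by omega)
    rw [← hk]
    have hk1 : (0 : ℝ) < k + 1 := by positivity
    have hab : (2 : ℝ) ^ k = 2 ^ (a + b) / 2 ^ δ := by
      rw [eq_div_iff (by positivity), ← pow_add]; congr 1; omega
    have h4 : (4 : ℝ) ^ a * 4 ^ b = 2 ^ (a + b) * 2 ^ (a + b) := by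
      rw [← pow_add, ← mul_pow]; norm_num
    rw [← le_div_iff₀' hk1] at h
    have hα' : 4 * α * (dyadicLevel z a).card * (dyadicLevel w b).card * 2 ^ k / (k + 1)
        ≤ 4 * α * (dyadicLevel z a).card * (dyadicLevel w b).card * 2 ^ k :=
      div_le_self (by positivity) (by linarith [(Nat.cast_nonneg k : (0 : ℝ) ≤ k)])
    rw [add_div] at h
    calc _ ≤ 4 * (2 : ℝ) ^ (a + b) *
          (4 * α * (dyadicLevel z a).card * (dyadicLevel w b).card * 2 ^ k
          + C * (subsetEntropy n (dyadicLevel z a).card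
            + subsetEntropy n (dyadicLevel w b).card) / (k + 1)) := by
          gcongr; linarith
      _ = 16 * α / 2 ^ δ * ((2 ^ (a + b) * 2 ^ (a + b)) * (dyadicLevel z a).card
          * (dyadicLevel w b).card) + 4 * C * (2 ^ (a + b) / (k + 1)
            * subsetEntropy n (dyadicLevel z a).card)
        + 4 * C * (2 ^ (a + b) / (k + 1) * subsetEntropy n (dyadicLevel w b).card) := by
          rw [hab]; field_simp; ring
      _ = _ := by rw [← h4]; ring
  have hprod : ∑ q ∈ balancedLevels L δ, ((4 : ℝ) ^ q.1 * (dyadicLevel z q.1).card)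
          * (4 ^ q.2 * (dyadicLevel w q.2).card) ≤ (16 * n) * (16 * n) := by
    calc _ ≤ ∑ q ∈ Finset.range L ×ˢ Finset.range L, ((4 : ℝ) ^ q.1 * (dyadicLevel z q.1).card)
          * (4 ^ q.2 * (dyadicLevel w q.2).card) :=
          Finset.sum_le_sum_of_subset_of_nonneg (Finset.filter_subset _ _)
            fun _ _ _ => by positivity
      _ = (∑ a ∈ Finset.range L, (4 : ℝ) ^ a * (dyadicLevel z a).card)
          * ∑ b ∈ Finset.range L, (4 : ℝ) ^ b * (dyadicLevel w b).card := by
          rw [Finset.sum_product, Finset.sum_mul_sum]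
      _ ≤ _ := by
          exact mul_le_mul ((sum_four_pow_mul_card_dyadicLevel_le z L).trans hz)
            ((sum_four_pow_mul_card_dyadicLevel_le w L).trans hw)
            (Finset.sum_nonneg fun _ _ => by positivity) (by positivity)
  have hent1 := sum_balancedLevels_le' (L := L) (δ := δ)
    (fun a => subsetEntropy n (dyadicLevel z a).card)
    (fun a => subsetEntropy_nonneg (card_dyadicLevel_le z a))
  have hent2 := sum_balancedLevels_le (L := L) (δ := δ)
    (fun a => subsetEntropy n (dyadicLevel w a).card)
    (fun a => subsetEntropy_nonneg (card_dyadicLevel_le w a))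
  have hs1 := sum_entropy_dyadicLevel_le hn z hz L
  have hs2 := sum_entropy_dyadicLevel_le hn w hw L
  refine (Finset.sum_le_sum hterm).trans ?_
  rw [Finset.sum_add_distrib, Finset.sum_add_distrib, ← Finset.mul_sum, ← Finset.mul_sum,
    ← Finset.mul_sum]
  calc _ ≤ 16 * α / 2 ^ δ * ((16 * n) * (16 * n)) + 4 * C * (4 * 2 ^ δ * (34 * n))
        + 4 * C * (4 * 2 ^ δ * (34 * n)) := by
        have h1 := hent1.trans (mul_le_mul_of_nonneg_left hs1 (by positivity))
        have h2 := hent2.trans (mul_le_mul_of_nonneg_left hs2 (by positivity))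
        have h3 := mul_le_mul_of_nonneg_left hprod (show 0 ≤ 16 * α / 2 ^ δ by positivity)
        have h4 := mul_le_mul_of_nonneg_left h1 (show 0 ≤ 4 * C by positivity)
        have h5 := mul_le_mul_of_nonneg_left h2 (show 0 ≤ 4 * C by positivity)
        exact add_le_add (add_le_add h3 h4) h5
    _ = _ := by ring

lemma heavy_sum_le (hn : 0 < n) {B : Fin n → Fin n → ℝ} (hB : ∀ i j, 0 ≤ B i j)
    {α C : ℝ} (hα : 0 < α) (hC : 0 ≤ C) (hd : 1 ≤ n * α)
    (hrow : ∀ i, ∑ j, B i j ≤ 3 * (n * α)) (hcol : ∀ j, ∑ i, B i j ≤ 3 * (n * α))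
    (hdisc : ∀ (I J : Finset (Fin n)) (k : ℕ), k ≤ 32 * n →
      (k + 1) * ∑ i ∈ I, ∑ j ∈ J, B i j
        ≤ 4 * α * I.card * J.card * 2 ^ k
          + C * (subsetEntropy n I.card + subsetEntropy n J.card))
    {z w : Fin n → ℕ} (hz : ∑ i, (z i : ℝ) ^ 2 ≤ 16 * n) (hw : ∑ i, (w i : ℝ) ^ 2 ≤ 16 * n) :
    ∑ i, ∑ j, (if 16 * √(n * α) < (z i : ℝ) * w j then (z i : ℝ) * w j * B i j else 0)
      ≤ (8576 + 1088 * C) * (n * √(n * α)) := by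
  have hsqrt : 1 ≤ √(n * α) := Real.one_le_sqrt.2 hd
  -- The choice `2 ^ δ ≤ √d < 2 ^ (δ + 1)`, with `d = n * α`, balances the contributions of order `n
  -- * d / 2 ^ δ` and `n * 2 ^ δ`.
  obtain ⟨δ, hδ1, hδ2⟩ := exists_nat_pow_near hsqrt one_lt_two
  set d := n * α with hd_def
  have hd0 : 0 < d := by linarith
  have hdd : √d * √d = d := Real.mul_self_sqrt hd0.le
  have hdδ : d / 2 ^ δ ≤ 2 * √d := by
    rw [div_le_iff₀ (by positivity)]
    rw [pow_succ] at hδ2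
    nlinarith
  set L := 16 * n + 1 with hL
  have h1 : ∑ i, ∑ j, 2 * (z i : ℝ) ^ 2 / 2 ^ δ * B i j ≤ 192 * (n * √d) := by
    calc _ = ∑ i, 2 * (z i : ℝ) ^ 2 / 2 ^ δ * ∑ j, B i j := by simp_rw [Finset.mul_sum]
      _ ≤ ∑ i, 2 * (z i : ℝ) ^ 2 / 2 ^ δ * (3 * d) := by gcongr with i; exact hrow i
      _ = 6 * (d / 2 ^ δ) * ∑ i, (z i : ℝ) ^ 2 := by
          rw [Finset.mul_sum]; refine Finset.sum_congr rfl fun i _ => ?_; ring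
      _ ≤ 6 * (2 * √d) * (16 * n) := by gcongr
      _ = _ := by ring
  have h2 : ∑ i, ∑ j, 2 * (w j : ℝ) ^ 2 / 2 ^ δ * B i j ≤ 192 * (n * √d) := by
    rw [Finset.sum_comm]
    calc _ = ∑ j, 2 * (w j : ℝ) ^ 2 / 2 ^ δ * ∑ i, B i j := by simp_rw [Finset.mul_sum]
      _ ≤ ∑ j, 2 * (w j : ℝ) ^ 2 / 2 ^ δ * (3 * d) := by gcongr with j; exact hcol j
      _ = 6 * (d / 2 ^ δ) * ∑ j, (w j : ℝ) ^ 2 := by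
          rw [Finset.mul_sum]; refine Finset.sum_congr rfl fun i _ => ?_; ring
      _ ≤ 6 * (2 * √d) * (16 * n) := by gcongr
      _ = _ := by ring
  have h3 : ∑ i, ∑ j, ∑ q ∈ balancedLevels L δ,
      (if (z i ≠ 0 ∧ Nat.log 2 (z i) = q.1) ∧ (w j ≠ 0 ∧ Nat.log 2 (w j) = q.2)
          then 4 * 2 ^ (q.1 + q.2) * B i j else 0)
      = ∑ q ∈ balancedLevels L δ, 4 * (2 : ℝ) ^ (q.1 + q.2) *
      ∑ i ∈ dyadicLevel z q.1, ∑ j ∈ dyadicLevel w q.2, B i j := by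
    simp_rw [fun i : Fin n => Finset.sum_comm (s := (Finset.univ : Finset (Fin n)))
      (t := balancedLevels L δ) (f := fun j q =>
      if (z i ≠ 0 ∧ Nat.log 2 (z i) = q.1) ∧ (w j ≠ 0 ∧ Nat.log 2 (w j) = q.2)
          then 4 * 2 ^ (q.1 + q.2) * B i j else 0)]
    rw [Finset.sum_comm]
    refine Finset.sum_congr rfl fun q _ => ?_
    simp_rw [dyadicLevel, Finset.sum_filter, Finset.mul_sum, ite_and]
    refine Finset.sum_congr rfl fun i _ => ?_
    split_ifs <;> simp [Finset.mul_sum]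
  have h4 := balanced_level_sum_le (δ := δ) hn hα hC hdisc hz hw
  calc _ ≤ ∑ i, ∑ j, (2 * (z i : ℝ) ^ 2 / 2 ^ δ * B i j + 2 * (w j : ℝ) ^ 2 / 2 ^ δ * B i j
        + ∑ q ∈ balancedLevels L δ,
        if (z i ≠ 0 ∧ Nat.log 2 (z i) = q.1) ∧ (w j ≠ 0 ∧ Nat.log 2 (w j) = q.2)
          then 4 * 2 ^ (q.1 + q.2) * B i j else 0) :=
        Finset.sum_le_sum fun i _ => Finset.sum_le_sum fun j _ =>
          heavy_term_le (hB i j) hδ1 (lt_of_sum_sq_le hz i) (lt_of_sum_sq_le hw j)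
    _ ≤ 192 * (n * √d) + 192 * (n * √d) +
        (4096 * α * n ^ 2 / 2 ^ δ + 1088 * C * 2 ^ δ * n) := by
        simp_rw [Finset.sum_add_distrib]
        rw [h3]
        linarith
    _ = 384 * (n * √d) + (4096 * n * (d / 2 ^ δ) + 1088 * C * 2 ^ δ * n) := by
        rw [hd_def]; ring
    _ ≤ 384 * (n * √d) + (4096 * n * (2 * √d) + 1088 * C * √d * n) := by gcongr
    _ = _ := by ring

end

/-! ### Discretisation of the spectral norm and the light/heavy split. -/

section

variable {n : ℕ}

/-- Rounding toward zero, unlike rounding to the nearest integer, does not increase the modulus. The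
grid points thus stay in the unit ball, and the last inequality lets a rounded vector serve as its
own test vector. -/
lemma exists_int_near_toward_zero (t : ℝ) : ∃ z : ℤ, |(z : ℝ)| ≤ |t| ∧ |t - z| ≤ 1 ∧ (z : ℝ) ^ 2 ≤ z * t := by
  rcases le_total 0 t with h | h
  · have hc : (0 : ℝ) ≤ ⌊t⌋ := by exact_mod_cast Int.floor_nonneg.2 h
    refine ⟨⌊t⌋, ?_, ?_, ?_⟩
    · rw [abs_of_nonneg h, abs_of_nonneg hc]
      exact Int.floor_le t
    · rw [abs_le]
      constructor <;> linarith [Int.floor_le t, Int.lt_floor_add_one t]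
    · nlinarith [Int.floor_le t]
  · have hc : (⌈t⌉ : ℝ) ≤ 0 := by exact_mod_cast Int.ceil_le.2 (by simpa using h)
    refine ⟨⌈t⌉, ?_, ?_, ?_⟩
    · rw [abs_of_nonpos h, abs_of_nonpos hc]
      linarith [Int.le_ceil t]
    · rw [abs_le]
      constructor <;> linarith [Int.le_ceil t, Int.ceil_lt_add_one t]
    · nlinarith [Int.le_ceil t]

lemma exists_grid_near (hn : 0 < n) (x : EuclideanSpace ℝ (Fin n)) (hx : ‖x‖ = 1) :
    ∃ z : Fin n → ℤ, ∑ i, (z i : ℝ) ^ 2 ≤ 16 * n ∧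
      ‖x - WithLp.toLp 2 (fun i => (z i : ℝ) / (4 * √n))‖ ≤ 1 / 4 ∧
      ‖(WithLp.toLp 2 (fun i => (z i : ℝ) / (4 * √n)) : EuclideanSpace ℝ (Fin n))‖ ≤ 1 := by
  choose z hz1 hz2 _ using fun i => exists_int_near_toward_zero (4 * √n * x i)
  have hn' : (0 : ℝ) < n := by exact_mod_cast hn
  have hs : 0 < √(n : ℝ) := Real.sqrt_pos.2 hn'
  have hss : √(n : ℝ) ^ 2 = n := Real.sq_sqrt hn'.le
  have hx2 : ∑ i, x i ^ 2 = 1 := by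
    rw [← EuclideanSpace.real_norm_sq_eq, hx]; norm_num
  have hzsq : ∑ i, (z i : ℝ) ^ 2 ≤ 16 * n := by
    calc _ ≤ ∑ i, (4 * √n * x i) ^ 2 := Finset.sum_le_sum fun i _ => sq_le_sq.2 (hz1 i)
      _ = 16 * n * ∑ i, x i ^ 2 := by
          rw [Finset.mul_sum]
          refine Finset.sum_congr rfl fun i _ => ?_
          rw [mul_pow, mul_pow, hss]; ring
      _ = _ := by rw [hx2, mul_one]
  refine ⟨z, hzsq, ?_, ?_⟩
  · refine abs_le_of_sq_le_sq' ?_ (by norm_num) |>.2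
    rw [EuclideanSpace.real_norm_sq_eq]
    calc _ ≤ ∑ _i : Fin n, 1 / (16 * (n : ℝ)) := by
          refine Finset.sum_le_sum fun i _ => ?_
          have h1 : (x - WithLp.toLp 2 (fun i => (z i : ℝ) / (4 * √n))) i
              = (4 * √n * x i - z i) / (4 * √n) := by
            simp; field_simp
          rw [h1, div_pow, mul_pow, hss]
          have h2 : (4 * √n * x i - z i) ^ 2 ≤ 1 := by
            rw [← sq_abs]; exact pow_le_one₀ (abs_nonneg _) (hz2 i)
          rw [show (4 : ℝ) ^ 2 = 16 by norm_num]
          gcongr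
      _ = _ := by simp; field_simp; norm_num
  · refine abs_le_of_sq_le_sq' ?_ (by norm_num) |>.2
    rw [EuclideanSpace.real_norm_sq_eq]
    calc _ = (∑ i, (z i : ℝ) ^ 2) / (16 * n) := by
          rw [Finset.sum_div]
          refine Finset.sum_congr rfl fun i _ => ?_
          simp only [div_pow, mul_pow, hss]
          norm_num
      _ ≤ _ := by
          rw [div_le_iff₀ (by positivity)]; linarith

/-- The points `z / (4 √n)` come within 1/4 of every unit vector. Replacing both arguments of the
bilinear form costs `‖T‖ / 4` each, hence `‖T‖ ≤ M / 16 + ‖T‖ / 2`. -/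
lemma l2_opNorm_le_of_grid (hn : 0 < n) (T : Matrix (Fin n) (Fin n) ℝ) {M : ℝ}
    (h : ∀ z w : Fin n → ℤ, ∑ i, (z i : ℝ) ^ 2 ≤ 16 * n → ∑ i, (w i : ℝ) ^ 2 ≤ 16 * n →
      ∑ i, ∑ j, (z i : ℝ) * w j * T i j ≤ M * n) : ‖T‖ ≤ M / 8 := by
  have hn' : (0 : ℝ) < n := by exact_mod_cast hn
  have hss : √(n : ℝ) * √n = n := Real.mul_self_sqrt hn'.le
  have hs : 0 < √(n : ℝ) := Real.sqrt_pos.2 hn'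
  have hM : 0 ≤ M := by
    have := h 0 0 (by simp) (by simp)
    simp at this
    exact nonneg_of_mul_nonneg_left this hn'
  set f := Matrix.toEuclideanCLM (n := Fin n) (𝕜 := ℝ) T with hf
  have hnorm : ‖T‖ = ‖f‖ := (Matrix.l2_opNorm_toEuclideanCLM T).symm
  have hmain : ‖f‖ ≤ M / 16 + ‖f‖ / 2 := by
    refine ContinuousLinearMap.opNorm_le_of_unit_norm (by positivity) fun y hy => ?_
    rcases eq_or_ne (f y) 0 with h0 | h0
    · rw [h0, norm_zero]; positivity
    set x := (‖f y‖)⁻¹ • f y with hx_def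
    have hfy : ‖f y‖ ≠ 0 := norm_ne_zero_iff.2 h0
    have hx : ‖x‖ = 1 := by
      rw [hx_def, norm_smul, norm_inv, norm_norm, inv_mul_cancel₀ hfy]
    have hin : inner ℝ x (f y) = ‖f y‖ := by
      rw [hx_def, real_inner_smul_left, real_inner_self_eq_norm_sq]; field_simp
    obtain ⟨z, hz, hxz, hzn⟩ := exists_grid_near hn x hx
    obtain ⟨w, hw, hyw, hwn⟩ := exists_grid_near hn y hy
    set u : EuclideanSpace ℝ (Fin n) := WithLp.toLp 2 (fun i => (z i : ℝ) / (4 * √n)) with hu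
    set v : EuclideanSpace ℝ (Fin n) := WithLp.toLp 2 (fun i => (w i : ℝ) / (4 * √n)) with hv
    have huv : inner ℝ u (f v) ≤ M / 16 := by
      rw [hf, Matrix.inner_toEuclideanCLM]
      have : (u.ofLp ⬝ᵥ T.mulVec v.ofLp)
          = (∑ i, ∑ j, (z i : ℝ) * w j * T i j) / (16 * n) := by
        simp only [dotProduct, Matrix.mulVec, hu, hv, Finset.mul_sum, Finset.sum_div]
        refine Finset.sum_congr rfl fun i _ => Finset.sum_congr rfl fun j _ => ?_
        rw [show 16 * (n : ℝ) = 4 * √n * (4 * √n) by linarith]; field_simp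
      rw [this]
      rw [div_le_iff₀ (by positivity)]
      calc _ ≤ M * n := h z w hz hw
        _ = _ := by ring
    have hsplit : inner ℝ x (f y) = inner ℝ u (f v) + inner ℝ (x - u) (f v)
        + inner ℝ x (f (y - v)) := by
      rw [map_sub, inner_sub_left, inner_sub_right]; ring
    have h1 : inner ℝ (x - u) (f v) ≤ ‖f‖ / 4 := by
      calc _ ≤ ‖x - u‖ * ‖f v‖ := real_inner_le_norm _ _
        _ ≤ (1 / 4) * (‖f‖ * 1) := by
            gcongr; exact (f.le_opNorm v).trans (by gcongr)
        _ = _ := by ring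
    have h2 : inner ℝ x (f (y - v)) ≤ ‖f‖ / 4 := by
      calc _ ≤ ‖x‖ * ‖f (y - v)‖ := real_inner_le_norm _ _
        _ ≤ 1 * (‖f‖ * (1 / 4)) := by
            rw [hx]; gcongr; exact (f.le_opNorm _).trans (by gcongr)
        _ = _ := by ring
    linarith
  rw [hnorm]; linarith

lemma l2_opNorm_sub_le (hn : 0 < n) {B P : Matrix (Fin n) (Fin n) ℝ}
    (hB : ∀ i j, 0 ≤ B i j) (hP : ∀ i j, 0 ≤ P i j)
    {α C C₂ : ℝ} (hα : 0 < α) (hC : 0 ≤ C) (hd : 1 ≤ n * α) (hPα : ∀ i j, P i j ≤ α)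
    (hrow : ∀ i, ∑ j, B i j ≤ 3 * (n * α)) (hcol : ∀ j, ∑ i, B i j ≤ 3 * (n * α))
    (hdisc : ∀ (I J : Finset (Fin n)) (k : ℕ), k ≤ 32 * n →
      (k + 1) * ∑ i ∈ I, ∑ j ∈ J, B i j
        ≤ 4 * α * I.card * J.card * 2 ^ k
          + C * (subsetEntropy n I.card + subsetEntropy n J.card))
    (hlight : ∀ z w : Fin n → ℤ, ∑ i, (z i : ℝ) ^ 2 ≤ 16 * n → ∑ i, (w i : ℝ) ^ 2 ≤ 16 * n →
      ∑ i, ∑ j, (if 16 * √(n * α) < |(z i : ℝ) * w j| then 0 else (z i : ℝ) * w j)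
        * (B i j - P i j) ≤ C₂ * (n * √(n * α))) :
    ‖B - P‖ ≤ (C₂ + 8592 + 1088 * C) / 8 * √(n * α) := by
  have hs : 0 < √(n * α) := Real.sqrt_pos.2 (by linarith)
  have hss : √(n * α) * √(n * α) = n * α := Real.mul_self_sqrt (by linarith)
  set D := √(n * α) with hD
  have hbound := l2_opNorm_le_of_grid hn (B - P) (M := (C₂ + 8592 + 1088 * C) * D) ?_
  · refine hbound.trans (le_of_eq ?_); ring
  intro z w hz hw
  have habs : ∀ u : Fin n → ℤ, ∑ i, ((u i).natAbs : ℝ) ^ 2 = ∑ i, (u i : ℝ) ^ 2 := by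
    intro u
    refine Finset.sum_congr rfl fun i _ => ?_
    rw [Nat.cast_natAbs, Int.cast_abs, sq_abs]
  have hheavy := heavy_sum_le hn hB hα hC hd hrow hcol hdisc
    (z := fun i => (z i).natAbs) (w := fun i => (w i).natAbs)
    ((habs z).trans_le hz) ((habs w).trans_le hw)
  rw [← hD] at hheavy
  have hl := hlight z w hz hw
  have hmean : ∑ i, ∑ j, α * ((z i : ℝ) ^ 2 * (w j : ℝ) ^ 2) / (16 * D) ≤ 16 * (n * D) := by
    have : ∑ i, ∑ j, α * ((z i : ℝ) ^ 2 * (w j : ℝ) ^ 2) / (16 * D)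
        = α * ((∑ i, (z i : ℝ) ^ 2) * ∑ j, (w j : ℝ) ^ 2) / (16 * D) := by
      rw [Finset.sum_mul_sum, Finset.mul_sum, Finset.sum_div]
      refine Finset.sum_congr rfl fun i _ => ?_
      rw [Finset.mul_sum, Finset.sum_div]
    rw [this, div_le_iff₀ (by positivity)]
    calc _ ≤ α * ((16 * n) * (16 * n)) := by gcongr
      _ = 256 * n * (D * D) := by rw [hss]; ring
      _ = _ := by ring
  have hpt : ∀ i j, (z i : ℝ) * w j * (B - P) i j ≤
      (if 16 * D < |(z i : ℝ) * w j| then 0 else (z i : ℝ) * w j) * (B i j - P i j)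
      + (if 16 * D < (((z i).natAbs : ℕ) : ℝ) * ((w j).natAbs : ℕ) then
          (((z i).natAbs : ℕ) : ℝ) * ((w j).natAbs : ℕ) * B i j else 0)
      + α * ((z i : ℝ) ^ 2 * (w j : ℝ) ^ 2) / (16 * D) := by
    intro i j
    have hc : (((z i).natAbs : ℕ) : ℝ) * ((w j).natAbs : ℕ) = |(z i : ℝ) * w j| := by
      rw [Nat.cast_natAbs, Nat.cast_natAbs, Int.cast_abs, Int.cast_abs, abs_mul]
    rw [hc, Matrix.sub_apply]
    set t := (z i : ℝ) * w j with ht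
    have ht2 : (z i : ℝ) ^ 2 * (w j : ℝ) ^ 2 = |t| * |t| := by rw [ht, abs_mul_abs_self]; ring
    rw [ht2]
    split_ifs with hcond
    · have h1 : t * B i j ≤ |t| * B i j := mul_le_mul_of_nonneg_right (le_abs_self t) (hB i j)
      have h2 : -(t * P i j) ≤ |t| * P i j := by
        rw [← neg_mul]; exact mul_le_mul_of_nonneg_right (neg_le_abs t) (hP i j)
      have h3 : |t| * P i j ≤ |t| * α := mul_le_mul_of_nonneg_left (hPα i j) (abs_nonneg t)
      -- On a heavy pair `1 ≤ |t| / (16 * D)`; this makes the mean of the heavy part quadratic in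
      -- the grid vectors.
      have h4 : |t| * α ≤ α * (|t| * |t|) / (16 * D) := by
        rw [le_div_iff₀ (by positivity)]
        have : 0 ≤ |t| * α := by positivity
        nlinarith
      linarith
    · have : 0 ≤ α * (|t| * |t|) / (16 * D) := by positivity
      linarith
  calc _ ≤ ∑ i, ∑ j, _ := Finset.sum_le_sum fun i _ => Finset.sum_le_sum fun j _ => hpt i j
    _ ≤ C₂ * (n * D) + (8576 + 1088 * C) * (n * D) + 16 * (n * D) := by
        simp_rw [Finset.sum_add_distrib]
        linarith
    _ = _ := by ring

end

/-! ### Random events: degrees and light products. -/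

section

open MeasureTheory

lemma sum_exp_neg_abs_le (K : ℕ) :
    ∑ k ∈ Finset.Icc (-(K : ℤ)) K, Real.exp (-|(k : ℝ)|) ≤ 3 := by
  have hexp : Real.exp (-1) ≤ 1 / 2 := by
    rw [Real.exp_neg, one_div]
    exact inv_anti₀ two_pos (by linarith [Real.add_one_le_exp (1 : ℝ)])
  have hterm : ∀ m : ℕ, Real.exp (-(m : ℝ)) ≤ (1 / 2) ^ m := fun m => by
    rw [← mul_neg_one, Real.exp_nat_mul]; gcongr
  suffices h : ∑ k ∈ Finset.Icc (-(K : ℤ)) K, Real.exp (-|(k : ℝ)|) ≤ 3 - 2 * (1 / 2) ^ K by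
    have : (0 : ℝ) ≤ (1 / 2) ^ K := by positivity
    linarith
  induction K with
  | zero => norm_num
  | succ K ih =>
    have hset : Finset.Icc (-((K + 1 : ℕ) : ℤ)) (K + 1 : ℕ)
        = insert ((K + 1 : ℕ) : ℤ) (insert (-((K + 1 : ℕ) : ℤ)) (Finset.Icc (-(K : ℤ)) K)) := by
      ext k
      simp only [Finset.mem_insert, Finset.mem_Icc]
      push_cast
      omega
    have habs : |(K : ℝ) + 1| = K + 1 := abs_of_nonneg (by positivity)
    rw [hset, Finset.sum_insert (by simp; omega), Finset.sum_insert (by simp)]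
    have := hterm (K + 1)
    push_cast at this ⊢
    rw [abs_neg, habs]
    rw [pow_succ] at *
    linarith

/-- This replaces a count of grid points. If the threshold for `z` includes `∑ |z i|`, the union
bound costs only `3 ^ n`, uniformly in the size `K` of the box. -/
lemma sum_piFinset_exp_neg_le (n K : ℕ) :
    ∑ z ∈ Fintype.piFinset (fun _ : Fin n => Finset.Icc (-(K : ℤ)) K),
      Real.exp (-∑ i, |(z i : ℝ)|) ≤ 3 ^ n := by
  have h : ∀ z : Fin n → ℤ, Real.exp (-∑ i, |(z i : ℝ)|) = ∏ i, Real.exp (-|(z i : ℝ)|) := by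
    intro z; rw [← Real.exp_sum, Finset.sum_neg_distrib]
  simp_rw [h]
  rw [← Finset.prod_univ_sum (fun _ : Fin n => Finset.Icc (-(K : ℤ)) K)
    (fun _ k => Real.exp (-|(k : ℝ)|))]
  calc _ ≤ ∏ _i : Fin n, (3 : ℝ) := Finset.prod_le_prod
        (fun _ _ => Finset.sum_nonneg fun _ _ => (Real.exp_pos _).le)
        fun _ _ => sum_exp_neg_abs_le K
    _ = _ := by simp

lemma exp_two_mul_sub_one_le {s : ℝ} (hs : |s| ≤ 1 / 2) :
    (Real.exp (2 * s) - 1) / 2 ≤ s + 2 * s ^ 2 := by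
  have h := Real.abs_exp_sub_one_sub_id_le (x := 2 * s) (by rw [abs_mul, abs_two]; linarith)
  have := (abs_le.1 h).2
  nlinarith

variable {Ω : Type*} [MeasurableSpace Ω] {μ : Measure Ω} {n : ℕ}
  {A : Ω → Matrix (Fin n) (Fin n) ℝ} {P : Matrix (Fin n) (Fin n) ℝ}

lemma HasPoissonTails.degree_bound (h : HasPoissonTails μ A P) [IsFiniteMeasure μ]
    (hP : ∀ i j, 0 ≤ P i j) (r : ℝ) :
    μ.real {ω | ¬ ∀ i, degree (A ω) i ≤ 2 * degree P i + 2 * r ∧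
      degree P i / 2 - 2 * r ≤ degree (A ω) i} ≤ 2 * n * Real.exp (-r) := by
  -- Coefficients `1/2` and `-1/2` on one row give the upper and the lower degree bound; the
  -- constants come from `e - 1 ≤ 2` and `1 - 1/e ≥ 1/2`.
  have hu := h.union_bound (Finset.univ : Finset (Fin n × Bool))
    (fun t i _ => if i = t.1 then (if t.2 then 1 / 2 else -(1 / 2)) else 0) (fun _ => r)
  refine (measureReal_mono ?_).trans (hu.trans (le_of_eq ?_))
  · intro ω hω
    by_contra hcon
    refine hω fun i₀ => ?_
    simp only [Set.mem_ofPred_eq, Finset.mem_univ, true_and, not_exists, not_lt] at hcon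
    have hdeg : ∀ (M : Matrix (Fin n) (Fin n) ℝ) (c : ℝ),
        ∑ i, ∑ j, (if i = i₀ then c else 0) * M i j = c * degree M i₀ := by
      intro M c
      rw [Finset.sum_eq_single i₀]
      · simp [degree, Finset.mul_sum]
      · intro i _ hi; simp [hi]
      · simp
    have hexp : ∀ c : ℝ, ∑ i, ∑ j, P i j * (Real.exp (2 * if i = i₀ then c else 0) - 1)
        = (Real.exp (2 * c) - 1) * degree P i₀ := by
      intro c
      rw [← hdeg]
      refine Finset.sum_congr rfl fun i _ => Finset.sum_congr rfl fun j _ => ?_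
      split_ifs <;> simp [mul_comm]
    have h1 := hcon (i₀, true)
    have h2 := hcon (i₀, false)
    simp only [if_true, Bool.false_eq_true, if_false] at h1 h2
    rw [hdeg, hexp] at h1 h2
    have hd : 0 ≤ degree P i₀ := Finset.sum_nonneg fun j _ => hP i₀ j
    have he1 : Real.exp (2 * (1 / 2)) ≤ 3 := by
      rw [show (2 : ℝ) * (1 / 2) = 1 by norm_num]
      linarith [Real.exp_one_lt_d9]
    have he2 : Real.exp (2 * (-(1 / 2))) ≤ 1 / 2 := by
      rw [show (2 : ℝ) * (-(1 / 2)) = -1 by norm_num, Real.exp_neg, one_div]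
      exact inv_anti₀ two_pos (by linarith [Real.add_one_le_exp (1 : ℝ)])
    constructor <;> nlinarith
  · simp; ring

lemma HasPoissonTails.light_bound (h : HasPoissonTails μ A P) [IsFiniteMeasure μ]
    (hn : 0 < n) (hP : ∀ i j, 0 ≤ P i j) {α : ℝ} (hα : 0 < α) (hPα : ∀ i j, P i j ≤ α) (c : ℝ) :
    μ.real {ω | ¬ ∀ z w : Fin n → ℤ, ∑ i, (z i : ℝ) ^ 2 ≤ 16 * n →
      ∑ i, (w i : ℝ) ^ 2 ≤ 16 * n →
      ∑ i, ∑ j, (if 16 * √(n * α) < |(z i : ℝ) * w j| then 0 else (z i : ℝ) * w j)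
        * (A ω i j - P i j) ≤ 32 * (33 + c) * (n * √(n * α))}
      ≤ 9 ^ n * Real.exp (-(c * n)) := by
  set D := √(n * α) with hD
  have hn' : (0 : ℝ) < n := by exact_mod_cast hn
  have hD0 : 0 < D := Real.sqrt_pos.2 (by positivity)
  have hDD : D * D = n * α := Real.mul_self_sqrt (by positivity)
  set box := Fintype.piFinset (fun _ : Fin n => Finset.Icc (-((16 * n : ℕ) : ℤ)) (16 * n : ℕ))
    with hbox
  set g : (Fin n → ℤ) × (Fin n → ℤ) → Fin n → Fin n → ℝ := fun t i j =>
    if 16 * D < |(t.1 i : ℝ) * t.2 j| then 0 else (t.1 i : ℝ) * t.2 j with hg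
  -- Light products are at most `16 * D` in modulus, so after division by `32 * D` they are at most
  -- 1/2 and the exponential is bounded quadratically. The quadratic terms total at most `n`. By
  -- integrality `∑ |z i| ≤ ∑ z i ^ 2 ≤ 16 * n`, so each threshold is `O(n)` on the grid.
  have hu := h.union_bound (box ×ˢ box) (fun t i j => g t i j / (32 * D))
    (fun t => ∑ i, |(t.1 i : ℝ)| + ∑ i, |(t.2 i : ℝ)| + c * n)
  refine (measureReal_mono ?_).trans (hu.trans ?_)
  · intro ω hω
    by_contra hcon
    refine hω fun z w hz hw => ?_
    simp only [Set.mem_ofPred_eq, not_exists, not_and, not_lt] at hcon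
    have hmem : ∀ u : Fin n → ℤ, ∑ i, (u i : ℝ) ^ 2 ≤ 16 * n → u ∈ box := by
      intro u hu
      refine Fintype.mem_piFinset.2 fun i => Finset.mem_Icc.2 ?_
      have h1 : (u i : ℝ) ^ 2 ≤ ∑ i, (u i : ℝ) ^ 2 :=
        Finset.single_le_sum (f := fun i => (u i : ℝ) ^ 2) (fun _ _ => by positivity)
          (Finset.mem_univ i)
      have h2 : (u i) ^ 2 ≤ 16 * (n : ℤ) := by exact_mod_cast h1.trans hu
      push_cast
      constructor <;> nlinarith
    have habs : ∀ u : Fin n → ℤ, ∑ i, (u i : ℝ) ^ 2 ≤ 16 * n → ∑ i, |(u i : ℝ)| ≤ 16 * n := by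
      intro u hu
      refine le_trans (Finset.sum_le_sum fun i _ => ?_) hu
      have : |u i| ≤ (u i) ^ 2 := by
        rw [← sq_abs]
        exact Int.le_self_sq _
      exact_mod_cast this
    have h1 := hcon (z, w) (Finset.mem_product.2 ⟨hmem z hz, hmem w hw⟩)
    dsimp only at h1
    have hgle : ∀ i j, |g (z, w) i j| ≤ 16 * D := by
      intro i j
      simp only [hg]
      split_ifs with hc
      · simp; positivity
      · exact not_lt.1 hc
    have hgsq : ∀ i j, (g (z, w) i j) ^ 2 ≤ (z i : ℝ) ^ 2 * (w j : ℝ) ^ 2 := by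
      intro i j
      simp only [hg]
      split_ifs with hc
      · rw [zero_pow two_ne_zero]; positivity
      · rw [mul_pow]
    have hpt : ∀ i j, P i j * (Real.exp (2 * (g (z, w) i j / (32 * D))) - 1) / 2
        ≤ g (z, w) i j / (32 * D) * P i j
          + 2 * α * ((z i : ℝ) ^ 2 * (w j : ℝ) ^ 2) / (32 * D) ^ 2 := by
      intro i j
      have h2 := exp_two_mul_sub_one_le (s := g (z, w) i j / (32 * D)) (by
        rw [abs_div, abs_of_pos (show 0 < 32 * D by positivity), div_le_iff₀ (by positivity)]
        linarith [hgle i j])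
      have h3 := mul_le_mul_of_nonneg_left h2 (hP i j)
      have h4 : P i j * (2 * (g (z, w) i j / (32 * D)) ^ 2)
          ≤ 2 * α * ((z i : ℝ) ^ 2 * (w j : ℝ) ^ 2) / (32 * D) ^ 2 := by
        rw [div_pow]
        calc _ = 2 * P i j * (g (z, w) i j) ^ 2 / (32 * D) ^ 2 := by ring
          _ ≤ _ := by
            gcongr
            · exact hPα i j
            · exact hgsq i j
      calc _ = P i j * ((Real.exp (2 * (g (z, w) i j / (32 * D))) - 1) / 2) := by ring
        _ ≤ _ := h3
        _ ≤ _ := by linarith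
    have hvar : ∑ i, ∑ j, 2 * α * ((z i : ℝ) ^ 2 * (w j : ℝ) ^ 2) / (32 * D) ^ 2 ≤ (n : ℝ) := by
      have : ∑ i, ∑ j, 2 * α * ((z i : ℝ) ^ 2 * (w j : ℝ) ^ 2) / (32 * D) ^ 2
          = 2 * α * ((∑ i, (z i : ℝ) ^ 2) * ∑ j, (w j : ℝ) ^ 2) / (32 * D) ^ 2 := by
        rw [Finset.sum_mul_sum, Finset.mul_sum, Finset.sum_div]
        refine Finset.sum_congr rfl fun i _ => ?_
        rw [Finset.mul_sum, Finset.sum_div]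
      rw [this, div_le_iff₀ (by positivity)]
      calc _ ≤ 2 * α * ((16 * n) * (16 * n)) := by gcongr
        _ = 512 * n * (n * α) := by ring
        _ ≤ 1024 * n * (D * D) := by rw [hDD]; gcongr; norm_num
        _ = _ := by ring
    have hsum : (∑ i, ∑ j, P i j * (Real.exp (2 * (g (z, w) i j / (32 * D))) - 1)) / 2
        ≤ ∑ i, ∑ j, g (z, w) i j / (32 * D) * P i j + n := by
      rw [Finset.sum_div]
      simp_rw [Finset.sum_div]
      refine (Finset.sum_le_sum fun i _ => Finset.sum_le_sum fun j _ => hpt i j).trans ?_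
      simp_rw [Finset.sum_add_distrib]
      linarith
    have hfin : ∑ i, ∑ j, g (z, w) i j * (A ω i j - P i j)
        = 32 * D * (∑ i, ∑ j, g (z, w) i j / (32 * D) * A ω i j
          - ∑ i, ∑ j, g (z, w) i j / (32 * D) * P i j) := by
      rw [← Finset.sum_sub_distrib, Finset.mul_sum]
      refine Finset.sum_congr rfl fun i _ => ?_
      rw [← Finset.sum_sub_distrib, Finset.mul_sum]
      refine Finset.sum_congr rfl fun j _ => ?_
      field_simp
    refine (le_of_eq hfin).trans ?_
    calc _ ≤ 32 * D * (n + (16 * n + 16 * n + c * n)) := by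
          gcongr
          linarith [habs z hz, habs w hw]
      _ = _ := by ring
  · have hsplit : ∀ t : (Fin n → ℤ) × (Fin n → ℤ),
        Real.exp (-(∑ i, |(t.1 i : ℝ)| + ∑ i, |(t.2 i : ℝ)| + c * n))
        = Real.exp (-(c * n)) * (Real.exp (-∑ i, |(t.1 i : ℝ)|)
          * Real.exp (-∑ i, |(t.2 i : ℝ)|)) := by
      intro t; rw [← Real.exp_add, ← Real.exp_add]; congr 1; ring
    simp_rw [hsplit]
    rw [← Finset.mul_sum, Finset.sum_product, mul_comm]
    simp_rw [← Finset.mul_sum]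
    rw [← Finset.sum_mul]
    have h3 := sum_piFinset_exp_neg_le n (16 * n)
    have h0 : 0 ≤ ∑ z ∈ box, Real.exp (-∑ i, |(z i : ℝ)|) :=
      Finset.sum_nonneg fun _ _ => (Real.exp_pos _).le
    calc _ ≤ (3 ^ n * 3 ^ n : ℝ) * Real.exp (-(c * n)) :=
          mul_le_mul_of_nonneg_right (mul_le_mul h3 h3 h0 (by positivity)) (Real.exp_pos _).le
      _ = _ := by rw [← mul_pow]; norm_num

end

/-! ### Random events: discrepancy and squared degree deviations. -/

section

open MeasureTheory

lemma log_le_subsetEntropy {n m : ℕ} (hm : 0 < m) (hmn : m ≤ n) :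
    Real.log n ≤ subsetEntropy n m := by
  have hm' : (1 : ℝ) ≤ m := by exact_mod_cast hm
  have hm0 : (0 : ℝ) < m := by linarith
  have hn0 : (0 : ℝ) < n := by exact_mod_cast hm.trans_le hmn
  have h1 : Real.log (n / m) = Real.log n - Real.log m := Real.log_div hn0.ne' hm0.ne'
  have h2 := Real.log_le_sub_one_of_pos hm0
  have h3 : 0 ≤ Real.log (n / m) :=
    Real.log_nonneg (by rw [one_le_div hm0]; exact_mod_cast hmn)
  unfold subsetEntropy
  nlinarith

/-- From `n.choose m ≤ n ^ m / m!` and `m ^ m / m! ≤ e ^ m`. -/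
lemma choose_mul_exp_neg_subsetEntropy_le {n m : ℕ} (hm : 0 < m) (hmn : m ≤ n) :
    (n.choose m : ℝ) * Real.exp (-subsetEntropy n m) ≤ 1 := by
  have hm0 : (0 : ℝ) < m := by exact_mod_cast hm
  have hn0 : (0 : ℝ) < n := by exact_mod_cast hm.trans_le hmn
  have h1 : Real.exp (-subsetEntropy n m) = (m / n : ℝ) ^ m * Real.exp (-m) := by
    have : (m / n : ℝ) ^ m = Real.exp (m * Real.log (m / n)) := by
      rw [Real.exp_nat_mul, Real.exp_log (by positivity)]
    rw [this, ← Real.exp_add, subsetEntropy, Real.log_div hn0.ne' hm0.ne',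
      Real.log_div hm0.ne' hn0.ne']
    congr 1; ring
  have h2 : (n.choose m : ℝ) ≤ n ^ m / m.factorial := Nat.choose_le_pow_div m n
  have h3 := Real.pow_div_factorial_le_exp (m : ℝ) hm0.le m
  rw [h1]
  calc _ ≤ (n : ℝ) ^ m / m.factorial * ((m / n : ℝ) ^ m * Real.exp (-m)) := by gcongr
    _ = (m : ℝ) ^ m / m.factorial * Real.exp (-m) := by rw [div_pow]; field_simp
    _ ≤ Real.exp m * Real.exp (-m) := by gcongr
    _ = 1 := by rw [← Real.exp_add]; simp

lemma sum_exp_neg_subsetEntropy_le (n : ℕ) :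
    ∑ I ∈ Finset.univ.filter (fun I : Finset (Fin n) => I.Nonempty),
      Real.exp (-subsetEntropy n I.card) ≤ n := by
  rw [Finset.sum_filter]
  have h := Finset.sum_powerset_apply_card
    (fun m => if 0 < m then Real.exp (-subsetEntropy n m) else 0) (x := (Finset.univ : Finset (Fin n)))
  simp only [Finset.powerset_univ, Finset.card_pos, Finset.card_univ, Fintype.card_fin] at h
  rw [h, Finset.sum_range_succ']
  simp only [lt_self_iff_false, if_false, smul_zero, add_zero, Nat.succ_pos, if_true, nsmul_eq_mul]
  calc _ ≤ ∑ _m ∈ Finset.range n, (1 : ℝ) := Finset.sum_le_sum fun m hm =>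
        choose_mul_exp_neg_subsetEntropy_le (Nat.succ_pos m) (Finset.mem_range.1 hm)
    _ = n := by simp

variable {Ω : Type*} [MeasurableSpace Ω] {μ : Measure Ω} {n : ℕ}
  {A : Ω → Matrix (Fin n) (Fin n) ℝ} {P : Matrix (Fin n) (Fin n) ℝ}

/-- One unit of `c` pays for the number of subsets of each size. The rest is at least `(c - 1) * log
n`, since a nonempty set has entropy at least `log n`, and supplies the polynomial decay. -/
lemma sum_exp_neg_mul_subsetEntropy_le {c : ℝ} (hc : 1 ≤ c) :
    ∑ I ∈ Finset.univ.filter (fun I : Finset (Fin n) => I.Nonempty),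
      Real.exp (-(c * subsetEntropy n I.card)) ≤ n * Real.exp (-((c - 1) * Real.log n)) := by
  calc _ ≤ ∑ I ∈ Finset.univ.filter (fun I : Finset (Fin n) => I.Nonempty),
        Real.exp (-subsetEntropy n I.card) * Real.exp (-((c - 1) * Real.log n)) := by
        refine Finset.sum_le_sum fun I hI => ?_
        rw [← Real.exp_add]
        refine Real.exp_le_exp.2 ?_
        have hle := log_le_subsetEntropy (n := n)
          (Finset.card_pos.2 (Finset.mem_filter.1 hI).2) (by simpa using Finset.card_le_univ I)
        nlinarith
    _ ≤ _ := by
        rw [← Finset.sum_mul]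
        exact mul_le_mul_of_nonneg_right (sum_exp_neg_subsetEntropy_le n) (Real.exp_pos _).le

lemma HasPoissonTails.discrepancy_bound (h : HasPoissonTails μ A P) [IsFiniteMeasure μ]
    {α : ℝ} (hα : 0 < α) (hPα : ∀ i j, P i j ≤ α) {c : ℝ} (hc : 1 ≤ c) :
    μ.real {ω | ¬ ∀ (I J : Finset (Fin n)) (k : ℕ), k ≤ 32 * n →
      (k + 1) * ∑ i ∈ I, ∑ j ∈ J, A ω i j
        ≤ 4 * α * I.card * J.card * 2 ^ k
          + 4 * c * (subsetEntropy n I.card + subsetEntropy n J.card)}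
      ≤ (32 * n + 1) * (n * Real.exp (-((c - 1) * Real.log n))) ^ 2 := by
  set N := Finset.univ.filter (fun I : Finset (Fin n) => I.Nonempty) with hN
  -- With this coefficient `exp (2 * s) = 2 ^ (k + 1)` on `I × J`. Keeping every Chernoff parameter
  -- `k` avoids optimising it for each pair of sets; the range covers all sums of two dyadic levels
  -- below `16 * n + 1`.
  have hu := h.union_bound (N ×ˢ N ×ˢ Finset.range (32 * n + 1))
    (fun t i j => if i ∈ t.1 ∧ j ∈ t.2.1 then (t.2.2 + 1) * Real.log 2 / 2 else 0)
    (fun t => c * subsetEntropy n t.1.card + c * subsetEntropy n t.2.1.card)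
  refine (measureReal_mono ?_).trans (hu.trans ?_)
  · intro ω hω
    by_contra hcon
    refine hω fun I J k hk => ?_
    simp only [Set.mem_ofPred_eq, not_exists, not_and, not_lt] at hcon
    have hent : ∀ I : Finset (Fin n), 0 ≤ subsetEntropy n I.card := fun I =>
      subsetEntropy_nonneg (by simpa using Finset.card_le_univ I)
    rcases I.eq_empty_or_nonempty with rfl | hI
    · have := hent J
      simp [subsetEntropy_zero]
      positivity
    rcases J.eq_empty_or_nonempty with rfl | hJ
    · have := hent I
      simp [subsetEntropy_zero]
      positivity
    have h1 := hcon (I, J, k) (by simp [hN, hI, hJ]; omega)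
    dsimp only at h1
    have hblock : ∀ (M : Matrix (Fin n) (Fin n) ℝ) (t : ℝ),
        ∑ i, ∑ j, (if i ∈ I ∧ j ∈ J then t else 0) * M i j = t * ∑ i ∈ I, ∑ j ∈ J, M i j := by
      intro M t
      have hi : ∀ i, ∑ j, (if i ∈ I ∧ j ∈ J then t else 0) * M i j
          = if i ∈ I then ∑ j ∈ J, t * M i j else 0 := by
        intro i
        by_cases hi : i ∈ I <;> simp [hi, ite_mul]
      simp_rw [hi, Finset.sum_ite_mem, Finset.univ_inter, Finset.mul_sum]
    rw [hblock] at h1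
    have hmean : ∑ i, ∑ j, P i j *
        (Real.exp (2 * if i ∈ I ∧ j ∈ J then ((k : ℝ) + 1) * Real.log 2 / 2 else 0) - 1)
        ≤ α * I.card * J.card * 2 ^ (k + 1) := by
      have hexp : Real.exp (2 * (((k : ℝ) + 1) * Real.log 2 / 2)) = 2 ^ (k + 1) := by
        rw [show 2 * (((k : ℝ) + 1) * Real.log 2 / 2) = ((k + 1 : ℕ) : ℝ) * Real.log 2 by
          push_cast; ring, Real.exp_nat_mul, Real.exp_log two_pos]
      calc _ = ∑ i, ∑ j, (if i ∈ I ∧ j ∈ J then ((2 : ℝ) ^ (k + 1) - 1) else 0) * P i j := by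
            refine Finset.sum_congr rfl fun i _ => Finset.sum_congr rfl fun j _ => ?_
            split_ifs
            · rw [hexp, mul_comm]
            · simp
        _ = ((2 : ℝ) ^ (k + 1) - 1) * ∑ i ∈ I, ∑ j ∈ J, P i j := hblock P _
        _ ≤ ((2 : ℝ) ^ (k + 1) - 1) * ∑ i ∈ I, ∑ j ∈ J, α := by
            have : (1 : ℝ) ≤ 2 ^ (k + 1) := one_le_pow₀ one_le_two
            refine mul_le_mul_of_nonneg_left ?_ (by linarith)
            exact Finset.sum_le_sum fun i _ => Finset.sum_le_sum fun j _ => hPα i j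
        _ = ((2 : ℝ) ^ (k + 1) - 1) * (α * I.card * J.card) := by
            simp only [Finset.sum_const, nsmul_eq_mul]; ring
        _ ≤ 2 ^ (k + 1) * (α * I.card * J.card) := by gcongr; linarith
        _ = _ := by ring
    have hlog : (1 : ℝ) / 2 ≤ Real.log 2 := by linarith [Real.log_two_gt_d9]
    set S := ∑ i ∈ I, ∑ j ∈ J, A ω i j with hS
    have hrhs : 0 ≤ α * I.card * J.card * 2 ^ (k + 1) / 2
        + c * (subsetEntropy n I.card + subsetEntropy n J.card) := by
      have := hent I
      have := hent J
      positivity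
    have h2 : (k + 1) * S * (Real.log 2 / 2) ≤ α * I.card * J.card * 2 ^ (k + 1) / 2
        + c * (subsetEntropy n I.card + subsetEntropy n J.card) := by linarith
    rcases le_or_gt ((k + 1) * S) 0 with h0 | h0
    · rw [pow_succ] at hrhs
      linarith
    · rw [pow_succ] at h2
      nlinarith
  · have hsplit : ∀ t : Finset (Fin n) × Finset (Fin n) × ℕ,
        Real.exp (-(c * subsetEntropy n t.1.card + c * subsetEntropy n t.2.1.card))
        = Real.exp (-(c * subsetEntropy n t.1.card))
          * Real.exp (-(c * subsetEntropy n t.2.1.card)) := by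
      intro t; rw [← Real.exp_add]; congr 1; ring
    simp_rw [hsplit]
    rw [Finset.sum_product]
    simp_rw [← Finset.mul_sum]
    rw [← Finset.sum_mul, Finset.sum_product]
    simp only [Finset.sum_const, Finset.card_range, nsmul_eq_mul]
    rw [← Finset.mul_sum]
    have h3 := sum_exp_neg_mul_subsetEntropy_le (n := n) hc
    rw [← hN] at h3
    have h0 : 0 ≤ ∑ I ∈ N, Real.exp (-(c * subsetEntropy n I.card)) :=
      Finset.sum_nonneg fun _ _ => (Real.exp_pos _).le
    have h4 := pow_le_pow_left₀ h0 h3 2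
    push_cast
    calc _ = (32 * (n : ℝ) + 1) * (∑ I ∈ N, Real.exp (-(c * subsetEntropy n I.card))) ^ 2 := by ring
      _ ≤ _ := by gcongr

/-- Duality: the deviation vector `U` is tested against its own rounding `z` of `U / √D`. The test
value is at least `∑ z i ^ 2 / 4`, while the tail bound allows only `∑ z i ^ 2 / 8 + ∑ |z i| + c *
n`, so `∑ z i ^ 2 = O(n)`. The a priori bound on the deviations keeps the coefficients `z i / (4
√D)` within 1/2, as the quadratic bound on the exponential requires. -/
lemma HasPoissonTails.sum_sq_degree_bound (h : HasPoissonTails μ A P) [IsFiniteMeasure μ]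
    (hP : ∀ i j, 0 ≤ P i j) {D : ℝ} (hD : 0 < D) (hPD : ∀ i, degree P i ≤ D) (c : ℝ) :
    μ.real {ω | ¬ ((∀ i, |degree (A ω) i - degree P i| ≤ 2 * D) →
      ∑ i, (degree (A ω) i - degree P i) ^ 2 ≤ (130 + 32 * c) * (n * D))}
      ≤ 3 ^ n * Real.exp (-(c * n)) := by
  have hs : 0 < √D := Real.sqrt_pos.2 hD
  have hss : √D * √D = D := Real.mul_self_sqrt hD.le
  obtain ⟨K, hK⟩ := exists_nat_ge (2 * √D)
  have hu := h.union_bound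
    ((Fintype.piFinset (fun _ : Fin n => Finset.Icc (-(K : ℤ)) K)).filter
      fun z => ∀ i, |(z i : ℝ)| ≤ 2 * √D)
    (fun z i _ => z i / (4 * √D)) (fun z => ∑ i, |(z i : ℝ)| + c * n)
  refine (measureReal_mono ?_).trans (hu.trans ?_)
  · intro ω hω
    by_contra hcon
    refine hω fun hdev => ?_
    simp only [Set.mem_ofPred_eq, not_exists, not_and, not_lt] at hcon
    set U : Fin n → ℝ := fun i => degree (A ω) i - degree P i with hU
    choose z hz1 hz2 hz3 using fun i => exists_int_near_toward_zero (U i / √D)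
    have hz4 : ∀ i, |(z i : ℝ)| ≤ 2 * √D := by
      intro i
      refine (hz1 i).trans ?_
      rw [abs_div, abs_of_pos hs, div_le_iff₀ hs]
      calc _ ≤ 2 * D := hdev i
        _ = _ := by rw [mul_assoc, hss]
    have hmem : z ∈ (Fintype.piFinset (fun _ : Fin n => Finset.Icc (-(K : ℤ)) K)).filter
        fun z => ∀ i, |(z i : ℝ)| ≤ 2 * √D := by
      refine Finset.mem_filter.2 ⟨Fintype.mem_piFinset.2 fun i => Finset.mem_Icc.2 ?_, hz4⟩
      have : |z i| ≤ (K : ℤ) := by exact_mod_cast (hz4 i).trans hK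
      exact abs_le.1 this
    have h1 := hcon z hmem
    have hrow : ∀ M : Matrix (Fin n) (Fin n) ℝ,
        ∑ i, ∑ j, (z i : ℝ) / (4 * √D) * M i j = ∑ i, (z i : ℝ) / (4 * √D) * degree M i := by
      intro M; simp_rw [degree, Finset.mul_sum]
    have hmean : (∑ i, ∑ j, P i j * (Real.exp (2 * ((z i : ℝ) / (4 * √D))) - 1)) / 2
        ≤ ∑ i, ((z i : ℝ) / (4 * √D) * degree P i + (z i : ℝ) ^ 2 / 8) := by
      rw [Finset.sum_div]
      refine Finset.sum_le_sum fun i _ => ?_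
      rw [← Finset.sum_mul]
      have h2 := exp_two_mul_sub_one_le (s := (z i : ℝ) / (4 * √D)) (by
        rw [abs_div, abs_of_pos (show 0 < 4 * √D by positivity), div_le_iff₀ (by positivity)]
        linarith [hz4 i])
      have hd : 0 ≤ degree P i := Finset.sum_nonneg fun j _ => hP i j
      have h3 := mul_le_mul_of_nonneg_left h2 hd
      have h4 : degree P i * (2 * ((z i : ℝ) / (4 * √D)) ^ 2) ≤ (z i : ℝ) ^ 2 / 8 := by
        rw [div_pow, mul_pow, sq (√D), hss]
        calc _ ≤ D * (2 * ((z i : ℝ) ^ 2 / (4 ^ 2 * D))) := by gcongr; exact hPD i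
          _ = _ := by field_simp; ring
      change degree P i * _ / 2 ≤ _
      linarith
    rw [hrow] at h1
    have h2 : ∑ i, (z i : ℝ) / (4 * √D) * U i ≤ ∑ i, ((z i : ℝ) ^ 2 / 8 + |(z i : ℝ)|) + c * n := by
      have h3 := h1.trans (add_le_add_left hmean _)
      simp only [hU, mul_sub, Finset.sum_sub_distrib]
      simp only [Finset.sum_add_distrib] at h3 ⊢
      linarith
    have h3 : ∑ i, (z i : ℝ) ^ 2 / 4 ≤ ∑ i, (z i : ℝ) / (4 * √D) * U i := by
      refine Finset.sum_le_sum fun i _ => ?_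
      calc _ ≤ (z i * (U i / √D)) / 4 := by linarith [hz3 i]
        _ = _ := by field_simp
    -- The coefficient 3/16 is below the 1/4 on the other side, so the square sum can be absorbed.
    have h4 : ∀ i, (z i : ℝ) ^ 2 / 8 + |(z i : ℝ)| ≤ 3 / 16 * (z i : ℝ) ^ 2 + 4 := by
      intro i
      rw [← sq_abs (z i : ℝ)]
      nlinarith [sq_nonneg (|(z i : ℝ)| - 8)]
    have h5 : ∑ i, (z i : ℝ) ^ 2 ≤ 64 * n + 16 * (c * n) := by
      have h6 := (h3.trans h2).trans
        (add_le_add_left (Finset.sum_le_sum fun i _ => h4 i) _)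
      rw [← Finset.sum_div, Finset.sum_add_distrib, ← Finset.mul_sum] at h6
      simp at h6
      linarith
    have h6 : ∀ i, U i ^ 2 ≤ D * (2 * (z i : ℝ) ^ 2 + 2) := by
      intro i
      have h7 : |U i / √D| ≤ |(z i : ℝ)| + 1 := by
        have := abs_sub_abs_le_abs_sub (U i / √D) (z i)
        linarith [hz2 i]
      have h8 : (U i / √D) ^ 2 ≤ 2 * (z i : ℝ) ^ 2 + 2 := by
        rw [← sq_abs (U i / √D), ← sq_abs (z i : ℝ)]
        nlinarith [abs_nonneg (U i / √D), abs_nonneg (z i : ℝ), sq_nonneg (|(z i : ℝ)| - 1)]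
      rw [div_pow, sq (√D), hss, div_le_iff₀ hD] at h8
      linarith
    calc _ ≤ ∑ i, D * (2 * (z i : ℝ) ^ 2 + 2) := Finset.sum_le_sum fun i _ => h6 i
      _ = D * (2 * ∑ i, (z i : ℝ) ^ 2 + 2 * n) := by
          rw [← Finset.mul_sum, Finset.sum_add_distrib, ← Finset.mul_sum, Finset.sum_const,
            Finset.card_univ, Fintype.card_fin, nsmul_eq_mul]; ring
      _ ≤ D * (2 * (64 * n + 16 * (c * n)) + 2 * n) := by gcongr
      _ = _ := by ring
  · calc _ ≤ ∑ z ∈ Fintype.piFinset (fun _ : Fin n => Finset.Icc (-(K : ℤ)) K),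
          Real.exp (-(∑ i, |(z i : ℝ)| + c * n)) :=
          Finset.sum_le_sum_of_subset_of_nonneg (Finset.filter_subset _ _)
            fun _ _ _ => (Real.exp_pos _).le
      _ = (∑ z ∈ Fintype.piFinset (fun _ : Fin n => Finset.Icc (-(K : ℤ)) K),
          Real.exp (-(∑ i, |(z i : ℝ)|))) * Real.exp (-(c * n)) := by
          rw [Finset.sum_mul]
          refine Finset.sum_congr rfl fun z _ => ?_
          rw [← Real.exp_add]; congr 1; ring
      _ ≤ _ := by gcongr; exact sum_piFinset_exp_neg_le n K

end

/-! ### Deterministic perturbation of the normalized Laplacian. -/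

section

variable {n : ℕ}

lemma l2_opNorm_le_sqrt_sum_sq (M : Matrix (Fin n) (Fin n) ℝ) :
    ‖M‖ ≤ √(∑ i, ∑ j, M i j ^ 2) := by
  rw [← Matrix.l2_opNorm_toEuclideanCLM]
  refine ContinuousLinearMap.opNorm_le_bound _ (Real.sqrt_nonneg _) fun y => ?_
  have h0 : 0 ≤ ∑ i, ∑ j, M i j ^ 2 :=
    Finset.sum_nonneg fun i _ => Finset.sum_nonneg fun j _ => sq_nonneg _
  refine abs_le_of_sq_le_sq' ?_ (by positivity) |>.2
  rw [mul_pow, Real.sq_sqrt h0, EuclideanSpace.real_norm_sq_eq, EuclideanSpace.real_norm_sq_eq,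
    Finset.sum_mul]
  refine Finset.sum_le_sum fun i _ => ?_
  rw [Matrix.ofLp_toEuclideanCLM]
  exact Finset.sum_mul_sq_le_sq_mul_sq Finset.univ (fun j => M i j) y.ofLp

lemma sq_inv_sqrt_sub_inv_sqrt_le {x y m : ℝ} (hm : 0 < m) (hx : m ≤ x) (hy : m ≤ y) :
    ((√x)⁻¹ - (√y)⁻¹) ^ 2 ≤ (x - y) ^ 2 / m ^ 3 := by
  have hsx : 0 < √x := Real.sqrt_pos.2 (hm.trans_le hx)
  have hsy : 0 < √y := Real.sqrt_pos.2 (hm.trans_le hy)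
  have hxx : √x ^ 2 = x := Real.sq_sqrt (hm.le.trans hx)
  have hyy : √y ^ 2 = y := Real.sq_sqrt (hm.le.trans hy)
  have h1 : ((√x)⁻¹ - (√y)⁻¹) ^ 2 = (x - y) ^ 2 / (x * y * (√x + √y) ^ 2) := by
    have key : ∀ s t : ℝ, 0 < s → 0 < t →
        (s⁻¹ - t⁻¹) ^ 2 = (s ^ 2 - t ^ 2) ^ 2 / (s ^ 2 * t ^ 2 * (s + t) ^ 2) := by
      intro s t hs ht
      rw [eq_div_iff (by positivity)]
      field_simp
      ring
    rw [key _ _ hsx hsy, hxx, hyy]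
  rw [h1]
  have h2 : m ≤ (√x + √y) ^ 2 := by nlinarith
  have h3 : m ^ 3 ≤ x * y * (√x + √y) ^ 2 := by
    calc m ^ 3 = m * m * m := by ring
      _ ≤ _ := by
        have := hm.le.trans hx
        have := hm.le.trans hy
        gcongr
  gcongr

/-- The two terms with a difference of inverse square roots are bounded in Frobenius norm. There a
diagonal factor weights row or column square sums of `P`, so only the `ℓ²` size of the degree
deviations enters. -/
lemma norm_normalizedLaplacian_sub_le {B P : Matrix (Fin n) (Fin n) ℝ} {m S Q R : ℝ}
    (hm : 0 < m) (hB : ∀ i, m ≤ degree B i) (hP : ∀ i, m ≤ degree P i)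
    (hS : ‖B - P‖ ≤ S) (hQ : ∑ i, (degree B i - degree P i) ^ 2 ≤ Q) (hR0 : 0 ≤ R)
    (hrow : ∀ i, ∑ j, P i j ^ 2 ≤ R) (hcol : ∀ j, ∑ i, P i j ^ 2 ≤ R) :
    ‖normalizedLaplacian B - normalizedLaplacian P‖ ≤ S / m + 2 * √(Q * R) / m ^ 2 := by
  set a : Fin n → ℝ := fun i => (√(degree B i))⁻¹ with ha
  set b : Fin n → ℝ := fun i => (√(degree P i))⁻¹ with hb
  have hsm : 0 < √m := Real.sqrt_pos.2 hm
  have hssm : √m * √m = m := Real.mul_self_sqrt hm.le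
  have hdiag : ∀ (M : Matrix (Fin n) (Fin n) ℝ), (∀ i, m ≤ degree M i) →
      ‖Matrix.diagonal (fun i => (√(degree M i))⁻¹)‖ ≤ (√m)⁻¹ := by
    intro M hM
    rw [Matrix.l2_opNorm_diagonal, pi_norm_le_iff_of_nonneg (by positivity)]
    intro i
    rw [Real.norm_eq_abs, abs_of_nonneg (by positivity)]
    exact inv_anti₀ hsm (Real.sqrt_le_sqrt (hM i))
  have hda := hdiag B hB
  have hdb := hdiag P hP
  have hQ0 : 0 ≤ Q := (Finset.sum_nonneg fun i _ => sq_nonneg _).trans hQ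
  have hab : ∑ i, (a i - b i) ^ 2 ≤ Q / m ^ 3 := by
    calc _ ≤ ∑ i, (degree B i - degree P i) ^ 2 / m ^ 3 :=
          Finset.sum_le_sum fun i _ => sq_inv_sqrt_sub_inv_sqrt_le hm (hB i) (hP i)
      _ ≤ _ := by rw [← Finset.sum_div]; gcongr
  have hfrob : √(Q / m ^ 3 * R) * (√m)⁻¹ = √(Q * R) / m ^ 2 := by
    rw [← Real.sqrt_inv, ← Real.sqrt_mul (by positivity),
      show Q / m ^ 3 * R * m⁻¹ = Q * R / (m ^ 2) ^ 2 by field_simp,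
      Real.sqrt_div (by positivity), Real.sqrt_sq (by positivity)]
  have hleft : ‖Matrix.diagonal (fun i => a i - b i) * P‖ ≤ √(Q / m ^ 3 * R) := by
    refine (l2_opNorm_le_sqrt_sum_sq _).trans (Real.sqrt_le_sqrt ?_)
    calc _ = ∑ i, (a i - b i) ^ 2 * ∑ j, P i j ^ 2 := by
          refine Finset.sum_congr rfl fun i _ => ?_
          rw [Finset.mul_sum]
          refine Finset.sum_congr rfl fun j _ => ?_
          rw [Matrix.diagonal_mul, mul_pow]
      _ ≤ ∑ i, (a i - b i) ^ 2 * R := by gcongr with i; exact hrow i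
      _ ≤ _ := by rw [← Finset.sum_mul]; gcongr
  have hright : ‖P * Matrix.diagonal (fun i => a i - b i)‖ ≤ √(Q / m ^ 3 * R) := by
    refine (l2_opNorm_le_sqrt_sum_sq _).trans (Real.sqrt_le_sqrt ?_)
    rw [Finset.sum_comm]
    calc _ = ∑ j, (a j - b j) ^ 2 * ∑ i, P i j ^ 2 := by
          refine Finset.sum_congr rfl fun i _ => ?_
          rw [Finset.mul_sum]
          refine Finset.sum_congr rfl fun j _ => ?_
          rw [Matrix.mul_diagonal, mul_pow, mul_comm]
      _ ≤ ∑ j, (a j - b j) ^ 2 * R := by gcongr with j; exact hcol j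
      _ ≤ _ := by rw [← Finset.sum_mul]; gcongr
  have hsplit : normalizedLaplacian B - normalizedLaplacian P
      = Matrix.diagonal a * (B - P) * Matrix.diagonal a
        + Matrix.diagonal (fun i => a i - b i) * P * Matrix.diagonal a
        + Matrix.diagonal b * (P * Matrix.diagonal (fun i => a i - b i)) := by
    ext i j
    simp only [normalizedLaplacian, Matrix.sub_apply, Matrix.add_apply, Matrix.mul_diagonal,
      Matrix.diagonal_mul, ha, hb]
    ring
  have hmul : ∀ M N : Matrix (Fin n) (Fin n) ℝ, ‖M * N‖ ≤ ‖M‖ * ‖N‖ :=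
    fun M N => Matrix.l2_opNorm_mul M N
  rw [hsplit]
  have h1 : ‖Matrix.diagonal a * (B - P) * Matrix.diagonal a‖ ≤ S / m := by
    calc _ ≤ ‖Matrix.diagonal a‖ * ‖B - P‖ * ‖Matrix.diagonal a‖ :=
          (hmul _ _).trans (mul_le_mul_of_nonneg_right (hmul _ _) (norm_nonneg _))
      _ ≤ (√m)⁻¹ * S * (√m)⁻¹ := by
          have := (norm_nonneg (B - P)).trans hS
          gcongr
      _ = S / (√m * √m) := by field_simp
      _ = S / m := by rw [hssm]
  have h2 : ‖Matrix.diagonal (fun i => a i - b i) * P * Matrix.diagonal a‖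
      ≤ √(Q * R) / m ^ 2 := by
    rw [← hfrob]
    exact (hmul _ _).trans (mul_le_mul hleft hda (norm_nonneg _) (Real.sqrt_nonneg _))
  have h3 : ‖Matrix.diagonal b * (P * Matrix.diagonal (fun i => a i - b i))‖
      ≤ √(Q * R) / m ^ 2 := by
    rw [← hfrob, mul_comm (√(Q / m ^ 3 * R))]
    exact (hmul _ _).trans (mul_le_mul hdb hright (norm_nonneg _) (by positivity))
  calc _ ≤ _ := norm_add₃_le
    _ ≤ S / m + √(Q * R) / m ^ 2 + √(Q * R) / m ^ 2 := add_le_add (add_le_add h1 h2) h3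
    _ = _ := by ring

end

/-! ### Choice of constants and assembly. -/

section

open MeasureTheory

/-- The constant in the spectral norm concentration `‖A - P‖ ≤ C √(n α)`. -/
noncomputable def adjacencyConst (ν : ℝ) : ℝ :=
  (32 * (38 + ν) + 8592 + 1088 * (4 * (ν + 8))) / 8

/-- The constant in the concentration of the normalized Laplacian. -/
noncomputable def laplacianConst (ν : ℝ) : ℝ :=
  4 * adjacencyConst ν + 32 * √(130 + 32 * (ν + 4))

lemma adjacencyConst_pos {ν : ℝ} (hν : 0 < ν) : 0 < adjacencyConst ν := by
  unfold adjacencyConst; positivity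

lemma laplacianConst_pos {ν : ℝ} (hν : 0 < ν) : 0 < laplacianConst ν := by
  have := adjacencyConst_pos hν
  unfold laplacianConst; positivity

lemma one_sub_le_measureReal_of_compl_subset {Ω : Type*} [MeasurableSpace Ω] {μ : Measure Ω}
    [IsProbabilityMeasure μ] {G E : Set Ω} {ε : ℝ} (h : Gᶜ ⊆ E) (hE : μ.real E ≤ ε) :
    1 - ε ≤ μ.real G := by
  have h1 : (1 : ℝ) = μ.real (G ∪ Gᶜ) := by rw [Set.union_compl_self, probReal_univ]
  have h2 := measureReal_union_le (μ := μ) G Gᶜ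
  have h3 : μ.real Gᶜ ≤ μ.real E := measureReal_mono h
  linarith

lemma pow_mul_exp_neg_le {n : ℕ} (hn : 2 ≤ n) {b k c : ℝ} (hb : 0 ≤ b) (hbk : b ≤ Real.exp k)
    (hc : 0 ≤ c) : b ^ n * Real.exp (-((c + k) * n)) ≤ Real.exp (-(c * Real.log n)) := by
  have hlog : Real.log n ≤ n := (Real.log_le_sub_one_of_pos (by positivity)).trans (by linarith)
  calc _ ≤ Real.exp k ^ n * Real.exp (-((c + k) * n)) := by gcongr
    _ = Real.exp (-(c * n)) := by
        rw [← Real.exp_nat_mul, ← Real.exp_add]; congr 1; ring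
    _ ≤ _ := Real.exp_le_exp.2 (by nlinarith)

lemma exp_nat_mul_log {n : ℕ} (hn : 2 ≤ n) (k : ℕ) : Real.exp (k * Real.log n) = (n : ℝ) ^ k := by
  rw [Real.exp_nat_mul, Real.exp_log (by positivity)]

variable {n : ℕ}

/-- The deterministic part: the four events together control the normalized Laplacian. -/
lemma norm_normalizedLaplacian_sub_le_of_events {ν : ℝ} (hν : 0 < ν) (hn : 2 ≤ n)
    {B P : Matrix (Fin n) (Fin n) ℝ} (hBsymm : B.IsSymm)
    (hB : ∀ i j, 0 ≤ B i j) (hP : ∀ i j, 0 ≤ P i j) (hPsymm : ∀ i j, P i j = P j i)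
    {α nmin nmax : ℝ} (hα : 0 < α) (hnmin : 0 < nmin) (hPα : ∀ i j, P i j ≤ α)
    (hlow : ∀ i, α * nmin ≤ degree P i) (hup : ∀ i, degree P i ≤ α * nmax)
    (hlarge : 8 * (ν + 4) * Real.log n ≤ α * nmin)
    (hdeg : ∀ i, degree B i ≤ 2 * degree P i + 2 * ((ν + 4) * Real.log n) ∧
      degree P i / 2 - 2 * ((ν + 4) * Real.log n) ≤ degree B i)
    (hlight : ∀ z w : Fin n → ℤ, ∑ i, (z i : ℝ) ^ 2 ≤ 16 * n →
      ∑ i, (w i : ℝ) ^ 2 ≤ 16 * n →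
      ∑ i, ∑ j, (if 16 * √(n * α) < |(z i : ℝ) * w j| then 0 else (z i : ℝ) * w j)
        * (B i j - P i j) ≤ 32 * (38 + ν) * (n * √(n * α)))
    (hdisc : ∀ (I J : Finset (Fin n)) (k : ℕ), k ≤ 32 * n →
      (k + 1) * ∑ i ∈ I, ∑ j ∈ J, B i j
        ≤ 4 * α * I.card * J.card * 2 ^ k
          + 4 * (ν + 8) * (subsetEntropy n I.card + subsetEntropy n J.card))
    (hsq : (∀ i, |degree B i - degree P i| ≤ 2 * (α * nmax)) →
      ∑ i, (degree B i - degree P i) ^ 2 ≤ (130 + 32 * (ν + 4)) * (n * (α * nmax))) :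
    (∀ i, 0 < degree B i) ∧ ‖normalizedLaplacian B - normalizedLaplacian P‖
      ≤ laplacianConst ν * (nmax / nmin) * √n / (nmin * √α) := by
  have hn0 : 0 < n := by omega
  have hn' : (0 : ℝ) < n := by exact_mod_cast hn0
  have hlog : Real.log 2 ≤ Real.log n :=
    Real.log_le_log two_pos (by exact_mod_cast hn)
  have hlog2 := Real.log_two_gt_d9
  have hdP : ∀ i, degree P i ≤ n * α := fun i => by
    calc degree P i ≤ ∑ _j : Fin n, α := Finset.sum_le_sum fun j _ => hPα i j
      _ = _ := by simp
  have hr : ∀ i, 8 * ((ν + 4) * Real.log n) ≤ degree P i := fun i => by linarith [hlow i]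
  have hr0 : 0 < (ν + 4) * Real.log n := mul_pos (by linarith) (by linarith)
  let i₀ : Fin n := ⟨0, hn0⟩
  have hd : 1 ≤ n * α := by
    have h1 := hdP i₀
    have h2 := hr i₀
    nlinarith
  have hmin_max : nmin ≤ nmax := by
    have := (hlow i₀).trans (hup i₀)
    exact le_of_mul_le_mul_left this hα
  have hnmax : 0 < nmax := hnmin.trans_le hmin_max
  have hB3 : ∀ i, degree B i ≤ 3 * (n * α) := fun i => by linarith [hdeg i, hr i, hdP i]
  have hcol : ∀ j, ∑ i, B i j ≤ 3 * (n * α) := fun j => by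
    refine le_trans (le_of_eq ?_) (hB3 j)
    exact Finset.sum_congr rfl fun i _ => hBsymm.apply j i
  have hS := l2_opNorm_sub_le hn0 hB hP hα (by positivity) hd hPα hB3 hcol hdisc hlight
  have hQ := hsq fun i => by
    rw [abs_le]
    have := hdeg i
    have := hr i
    have := hup i
    constructor <;> linarith
  -- The fluctuation `2 * (ν + 4) * log n` is at most a quarter of the expected degree, so a degree
  -- of at least one half minus one quarter of it survives.
  have hm : 0 < α * nmin / 4 := by positivity
  have hBm : ∀ i, α * nmin / 4 ≤ degree B i := fun i => by linarith [hdeg i, hr i, hlow i]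
  have hPm : ∀ i, α * nmin / 4 ≤ degree P i := fun i => by
    have : 0 < α * nmin := by positivity
    linarith [hlow i]
  have hrow2 : ∀ i, ∑ j, P i j ^ 2 ≤ α * (α * nmax) := fun i => by
    calc _ ≤ ∑ j, α * P i j := Finset.sum_le_sum fun j _ => by
          rw [sq]; exact mul_le_mul_of_nonneg_right (hPα i j) (hP i j)
      _ = α * degree P i := by rw [← Finset.mul_sum]; rfl
      _ ≤ _ := by gcongr; exact hup i
  have hcol2 : ∀ j, ∑ i, P i j ^ 2 ≤ α * (α * nmax) := fun j => by
    simp_rw [fun i => hPsymm i j]; exact hrow2 j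
  refine ⟨fun i => hm.trans_le (hBm i), ?_⟩
  refine (norm_normalizedLaplacian_sub_le hm hBm hPm hS hQ (by positivity) hrow2 hcol2).trans ?_
  change adjacencyConst ν * √(n * α) / (α * nmin / 4) + _ ≤ _
  have hC := adjacencyConst_pos hν
  have hsα : 0 < √α := Real.sqrt_pos.2 hα
  have hssα : √α * √α = α := Real.mul_self_sqrt hα.le
  have h1 : adjacencyConst ν * √(n * α) / (α * nmin / 4)
      = 4 * adjacencyConst ν * √n / (nmin * √α) := by
    rw [Real.sqrt_mul hn'.le]
    nth_rewrite 2 [← hssα]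
    field_simp
  have h2 : √((130 + 32 * (ν + 4)) * (n * (α * nmax)) * (α * (α * nmax)))
      = √(130 + 32 * (ν + 4)) * √n * √α * (α * nmax) := by
    rw [show (130 + 32 * (ν + 4)) * (n * (α * nmax)) * (α * (α * nmax))
      = (130 + 32 * (ν + 4)) * n * α * (α * nmax) ^ 2 by ring,
      Real.sqrt_mul (by positivity), Real.sqrt_mul (by positivity), Real.sqrt_mul (by positivity),
      Real.sqrt_sq (by positivity)]
  have h3 : 2 * (√(130 + 32 * (ν + 4)) * √n * √α * (α * nmax)) / (α * nmin / 4) ^ 2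
      = 32 * √(130 + 32 * (ν + 4)) * (nmax / nmin) * √n / (nmin * √α) := by
    have : 2 * (√(130 + 32 * (ν + 4)) * √n * √α * (α * nmax)) / (α * nmin / 4) ^ 2
        = 32 * √(130 + 32 * (ν + 4)) * (nmax / nmin) * √n * √α / (nmin * α) := by
      field_simp
      norm_num
    rw [this, ← hssα, Real.sqrt_mul_self hsα.le]
    field_simp
  have h4 : 4 * adjacencyConst ν * √n / (nmin * √α)
      ≤ 4 * adjacencyConst ν * (nmax / nmin) * √n / (nmin * √α) := by
    have : 1 ≤ nmax / nmin := by rwa [one_le_div hnmin]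
    calc _ = 4 * adjacencyConst ν * 1 * √n / (nmin * √α) := by rw [mul_one]
      _ ≤ _ := by gcongr
  rw [h1, h2, h3]
  refine (add_le_add_left h4 _).trans (le_of_eq ?_)
  unfold laplacianConst
  ring

theorem normalizedLaplacian_concentration {ν : ℝ} (hν : 0 < ν) (hn : 2 ≤ n)
    {Ω : Type*} [MeasurableSpace Ω] {μ : Measure Ω} [IsProbabilityMeasure μ]
    {A : Ω → Matrix (Fin n) (Fin n) ℝ} {p : Matrix (Fin n) (Fin n) unitInterval}
    {P : Matrix (Fin n) (Fin n) ℝ} (hA : IsSymmBernoulliMatrix μ A p)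
    (hPp : ∀ i j, P i j = (p i j : ℝ))
    {α nmin nmax : ℝ} (hα : 0 < α) (hnmin : 0 < nmin) (hPα : ∀ i j, P i j ≤ α)
    (hlow : ∀ i, α * nmin ≤ degree P i) (hup : ∀ i, degree P i ≤ α * nmax)
    (hlarge : 8 * (ν + 4) * Real.log n ≤ α * nmin) :
    1 - (n : ℝ) ^ (-ν) ≤ μ.real {ω | (∀ i, 0 < degree (A ω) i) ∧
      ‖normalizedLaplacian (A ω) - normalizedLaplacian P‖
        ≤ laplacianConst ν * (nmax / nmin) * √n / (nmin * √α)} := by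
  have hn0 : 0 < n := by omega
  have hn' : (0 : ℝ) < n := by exact_mod_cast hn0
  have hn2 : (2 : ℝ) ≤ n := by exact_mod_cast hn
  have htail := hA.hasPoissonTails hPp
  have hP : ∀ i j, 0 ≤ P i j := fun i j => by rw [hPp]; exact (p i j).2.1
  have hPsymm : ∀ i j, P i j = P j i := fun i j => by rw [hPp, hPp]; exact hA.param_symm i j
  have hlog : 0 < Real.log n := Real.log_pos (by linarith)
  have hD : 0 < α * nmax := by
    have h1 := (hlow ⟨0, hn0⟩).trans (hup ⟨0, hn0⟩)
    have h2 : 0 < α * nmin := by positivity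
    linarith
  have he1 : (2.7 : ℝ) ≤ Real.exp 1 := by linarith [Real.exp_one_gt_d9]
  have he2 : (3 : ℝ) ≤ Real.exp 2 := by
    rw [show (2 : ℝ) = (2 : ℕ) * 1 by norm_num, Real.exp_nat_mul]
    nlinarith
  have he3 : (9 : ℝ) ≤ Real.exp 3 := by
    rw [show (3 : ℝ) = (3 : ℕ) * 1 by norm_num, Real.exp_nat_mul]
    calc (9 : ℝ) ≤ 2.7 ^ 3 := by norm_num
      _ ≤ _ := by gcongr
  -- Here `q = n ^ (-ν - 2)`: each of the four bad events has probability at most `q`, and `4 * q ≤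
  -- n ^ (-ν)` because `n ≥ 2`.
  set q := Real.exp (-((ν + 2) * Real.log n)) with hq
  have h1 := htail.degree_bound hP ((ν + 4) * Real.log n)
  have h2 := htail.light_bound hn0 hP hα hPα (ν + 5)
  have h3 := htail.discrepancy_bound hα hPα (c := ν + 8) (by linarith)
  have h4 := htail.sum_sq_degree_bound hP hD hup (ν + 4)
  have h1' : 2 * n * Real.exp (-((ν + 4) * Real.log n)) ≤ q := by
    calc _ ≤ (n : ℝ) ^ 2 * Real.exp (-((ν + 4) * Real.log n)) := by gcongr; nlinarith
      _ = q := by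
        rw [← exp_nat_mul_log hn, ← Real.exp_add, hq]; congr 1; push_cast; ring
  have h2' : 9 ^ n * Real.exp (-((ν + 5) * n)) ≤ q := by
    have := pow_mul_exp_neg_le hn (by norm_num) he3 (c := ν + 2) (by linarith)
    rwa [show ν + 2 + 3 = ν + 5 by ring] at this
  have h3' : (32 * n + 1) * (n * Real.exp (-((ν + 8 - 1) * Real.log n))) ^ 2 ≤ q := by
    have h5 : 32 * (n : ℝ) + 1 ≤ n ^ 7 := by
      have h6 : (2 : ℝ) ^ 6 ≤ n ^ 6 := by gcongr
      rw [pow_succ]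
      nlinarith
    calc _ ≤ (n : ℝ) ^ 7 * (n * Real.exp (-((ν + 8 - 1) * Real.log n))) ^ 2 := by gcongr
      _ = (n : ℝ) ^ 9 * Real.exp (-((ν + 8 - 1) * Real.log n)) ^ 2 := by ring
      _ = Real.exp ((9 : ℕ) * Real.log n + (2 : ℕ) * -((ν + 8 - 1) * Real.log n)) := by
        rw [← exp_nat_mul_log hn, ← Real.exp_nat_mul, ← Real.exp_add]
      _ ≤ q := by
        refine Real.exp_le_exp.2 ?_
        push_cast
        nlinarith
  have h4' : 3 ^ n * Real.exp (-((ν + 4) * n)) ≤ q := by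
    have := pow_mul_exp_neg_le hn (by norm_num) he2 (c := ν + 2) (by linarith)
    rwa [show ν + 2 + 2 = ν + 4 by ring] at this
  have h0 : μ.real {ω | ¬ ∀ i j, 0 ≤ A ω i j} = 0 := by
    rw [measureReal_eq_zero_iff]; exact hA.ae_nonneg
  have hq4 : 4 * q ≤ (n : ℝ) ^ (-ν) := by
    have : q = (n : ℝ) ^ (-ν) * ((n : ℝ) ^ 2)⁻¹ := by
      rw [Real.rpow_def_of_pos hn', ← exp_nat_mul_log hn, ← Real.exp_neg, ← Real.exp_add, hq]
      congr 1; push_cast; ring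
    rw [this]
    have h5 : ((n : ℝ) ^ 2)⁻¹ ≤ 1 / 4 := by
      rw [one_div]; exact inv_anti₀ (by norm_num) (by nlinarith)
    have h6 : 0 ≤ (n : ℝ) ^ (-ν) := by positivity
    nlinarith
  have hE := (measureReal_union_le (μ := μ) _ _).trans (add_le_add h0.le
    ((measureReal_union_le _ _).trans (add_le_add (h1.trans h1')
      ((measureReal_union_le _ _).trans (add_le_add (h2.trans h2')
        ((measureReal_union_le _ _).trans (add_le_add (h3.trans h3') (h4.trans h4'))))))))
  refine one_sub_le_measureReal_of_compl_subset ?_ (hE.trans (by linarith))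
  intro ω hω
  by_contra hcon
  simp only [Set.mem_union, Set.mem_ofPred_eq, not_or, not_not] at hcon
  obtain ⟨g0, g1, g2, g3, g4⟩ := hcon
  refine hω (norm_normalizedLaplacian_sub_le_of_events hν hn (hA.symm ω) g0 hP hPsymm hα hnmin
    hPα hlow hup hlarge g1 ?_ g3 g4)
  rwa [show 33 + (ν + 5) = 38 + ν by ring] at g2

end

theorem proposition3 (ν : ℝ) (hν : 0 < ν) :
    ∃ (C C' : ℝ) (K : ℝ → ℝ), 0 < C ∧ 0 < C' ∧ (∀ κ : ℝ, 0 < κ → 0 < K κ) ∧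
      ∀ (n : ℕ), 0 < n →
      ∀ (Ω : Type*) [MeasurableSpace Ω] (ℙ : MeasureTheory.Measure Ω)
        [MeasureTheory.IsProbabilityMeasure ℙ]
        (A : Ω → Matrix (Fin n) (Fin n) ℝ) (p : Matrix (Fin n) (Fin n) unitInterval)
        (P : Matrix (Fin n) (Fin n) ℝ) (α nmin nmax μB : ℝ),
        IsSymmBernoulliMatrix ℙ A p →
        (∀ i j, P i j = (p i j : ℝ)) →
        0 < α → 0 < nmin →
        (∀ i j, P i j ≤ α) →
        (∀ i, α * nmin ≤ ∑ j, P i j) →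
        (∀ i, ∑ j, P i j ≤ α * nmax) →
        μB = nmax / nmin →
        C' * μB * (Real.log n / nmin) ≤ α →
        1 - (n : ℝ) ^ (-ν) ≤ ℙ.real {ω | (∀ i, 0 < degree (A ω) i) ∧
            ‖normalizedLaplacian (A ω) - normalizedLaplacian P‖
              ≤ C * μB * √(n : ℝ) / (nmin * √α)} ∧
        (∀ κ : ℝ, 0 < κ → κ * n ≤ nmin →
          1 - (n : ℝ) ^ (-ν) ≤ ℙ.real {ω | (∀ i, 0 < degree (A ω) i) ∧
            ‖normalizedLaplacian (A ω) - normalizedLaplacian P‖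
              ≤ K κ / √(Real.log n)}) := by
  have hC := laplacianConst_pos hν
  have hC' : 0 < 8 * (ν + 4) := by linarith
  refine ⟨laplacianConst ν, 8 * (ν + 4),
    fun κ => laplacianConst ν / (κ * √κ * √(8 * (ν + 4))), hC, hC',
    fun κ hκ => by positivity, ?_⟩
  intro n hn Ω _ ℙ _ A p P α nmin nmax μB hA hPp hα hnmin hPα hlow hup hμ hlarge
  -- For `n = 1` the required probability is `1 - 1 = 0`.
  obtain rfl | hn2 : n = 1 ∨ 2 ≤ n := by omega
  · refine ⟨?_, fun κ _ _ => ?_⟩ <;>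
    · rw [Nat.cast_one, Real.one_rpow, sub_self]
      exact MeasureTheory.measureReal_nonneg
  have hn' : (0 : ℝ) < n := by exact_mod_cast hn
  have hlog : 0 < Real.log n := Real.log_pos (by exact_mod_cast hn2)
  let i₀ : Fin n := ⟨0, hn⟩
  have hmin_max : nmin ≤ nmax := le_of_mul_le_mul_left ((hlow i₀).trans (hup i₀)) hα
  have hdn : ∀ i, ∑ j, P i j ≤ α * n := fun i => by
    calc _ ≤ ∑ _j : Fin n, α := Finset.sum_le_sum fun j _ => hPα i j
      _ = _ := by simp [mul_comm]
  have hmin_n : nmin ≤ n := le_of_mul_le_mul_left ((hlow i₀).trans (hdn i₀)) hα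
  have hlarge' : 8 * (ν + 4) * Real.log n ≤ α * nmin := by
    have h1 : 1 ≤ μB := by rw [hμ, one_le_div hnmin]; exact hmin_max
    have h2 : 8 * (ν + 4) * μB * (Real.log n / nmin) * nmin = 8 * (ν + 4) * Real.log n * μB := by
      field_simp
    have h3 := mul_le_mul_of_nonneg_right hlarge hnmin.le
    rw [h2] at h3
    exact (le_mul_of_one_le_right (by positivity) h1).trans h3
  refine ⟨?_, fun κ hκ hκn => ?_⟩
  · rw [hμ]
    exact normalizedLaplacian_concentration hν hn2 hA hPp hα hnmin hPα hlow hup hlarge'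
  -- The given `nmax` may be far larger than `n`, so the concentration bound is applied with `n` in
  -- its place, which is legitimate since `P i j ≤ α`. The ratio is then at most `1 / κ`, and `K κ`
  -- does not depend on `μB`.
  · refine (normalizedLaplacian_concentration hν hn2 hA hPp hα hnmin hPα hlow hdn hlarge').trans
      (MeasureTheory.measureReal_mono fun ω hω => ⟨hω.1, hω.2.trans ?_⟩)
    have hsα : 0 < √α := Real.sqrt_pos.2 hα
    have hsκ : 0 < √κ := Real.sqrt_pos.2 hκ
    have hsm : 0 < √nmin := Real.sqrt_pos.2 hnmin
    have hssm : √nmin * √nmin = nmin := Real.mul_self_sqrt hnmin.le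
    have hsl : 0 < √(Real.log n) := Real.sqrt_pos.2 hlog
    have h1 : (n : ℝ) / nmin ≤ 1 / κ := by
      rw [div_le_div_iff₀ hnmin hκ]; linarith
    have h2 : √κ * √(n : ℝ) ≤ √nmin := by
      rw [← Real.sqrt_mul hκ.le]; exact Real.sqrt_le_sqrt hκn
    have h3 : √(8 * (ν + 4)) * √(Real.log n) ≤ √α * √nmin := by
      rw [← Real.sqrt_mul hC'.le, ← Real.sqrt_mul hα.le]; exact Real.sqrt_le_sqrt hlarge'
    have hsC : 0 < √(8 * (ν + 4)) := Real.sqrt_pos.2 hC'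
    have h4 : √(n : ℝ) / (nmin * √α) ≤ 1 / (√κ * (√(8 * (ν + 4)) * √(Real.log n))) := by
      rw [div_le_div_iff₀ (by positivity) (by positivity), one_mul]
      calc √(n : ℝ) * (√κ * (√(8 * (ν + 4)) * √(Real.log n)))
          = (√κ * √(n : ℝ)) * (√(8 * (ν + 4)) * √(Real.log n)) := by ring
        _ ≤ √nmin * (√α * √nmin) := by gcongr
        _ = (√nmin * √nmin) * √α := by ring
        _ = nmin * √α := by rw [hssm]
    calc laplacianConst ν * (n / nmin) * √(n : ℝ) / (nmin * √α)
        = laplacianConst ν * (n / nmin) * (√(n : ℝ) / (nmin * √α)) := by ring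
      _ ≤ laplacianConst ν * (1 / κ) * (1 / (√κ * (√(8 * (ν + 4)) * √(Real.log n)))) := by
          gcongr
      _ = laplacianConst ν / (κ * √κ * √(8 * (ν + 4))) / √(Real.log n) := by
          field_simp
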